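/- Let $n$ and $a_0$ be integers with $2\le a_0\le n-2$ and $a_0\equiv n\equiv 1\pmod 2$, and let $I=\{0,1,\dots,a_0-1\}\cup\{a_0+1,\dots,n-1\}$. Let $\mathcal D_n$ be the group of bijections $\sigma$ of $\{\pm1,\dots,\pm n\}$ such that $\sigma(-i)=-\sigma(i)$ for all $i$ and the number of $i\in\{1,\dots,n\}$ with $\sigma(i)<0$ is even. It is the Weyl group of the root system $\Phi=\{\pm(e_i\pm e_j): 1\le i<j\le n\}$, acting linearly by $\sigma(e_i)=e_{\sigma(i)}$ (where $e_{-i}=-e_i$). The simple roots are $e_1+e_2$ and $e_{i+1}-e_i$ $(1\le i\le n-1)$; write $\Phi^+$ for the set of roots that are nonnegative linear combinations of simple roots, and $\Phi^-=-\Phi^+$. The height of a root is the sum of its coefficients with respect to the simple roots. The corresponding Coxeter generators are $s_0=(1,-2)(2,-1)$ and $s_i=(i,i+1)(-i,-(i+1))$ for $1\le i\le n-1$. For $w\in\mathcal D_n$ let $$\ell(w)=|\{\alpha\in\Phi^+: w(\alpha)\in\Phi^-\}|,\qquad L(w)=|\{\alpha\in\Phi^+: \alpha\text{ has odd height and } w(\alpha)\in\Phi^-\}|,$$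 and let $$\mathcal D_n^I=\{w\in\mathcal D_n:\ \ell(ws_i)>\ell(w)\text{ for all } i\in I\},\qquad \mathcal D_n^I(x)=\sum_{w\in\mathcal D_n^I}(-1)^{\ell(w)}x^{L(w)}\in\mathbb Z[x].$$ Then $$\mathcal D_n^I(x)=\left[\begin{matrix}\frac{n-1}{2}\\ \frac{a_0-1}{2},\ \frac{n-a_0}{2}\end{matrix}\right]_{x^2}\ \prod_{i=a_0+1}^{n}\left(1+(-1)^{i-1}x^{\lfloor i/2\rfloor}\right),$$ where $\left[\begin{matrix}m\\ k_1,k_2\end{matrix}\right]_q=\dfrac{[m]_q!}{[k_1]_q!\,[k_2]_q!}$ for $k_1+k_2=m$, with $[m]_q!=\prod_{i=1}^m[i]_q$ and $[i]_q=\dfrac{1-q^i}{1-q}$. -/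

import Mathlib

noncomputable section

namespace TypeD

/-! ### Signed permutations

A signed permutation of degree `n` is a bijection of `{±1, …, ±n}` commuting with negation.  It is
regarded as a permutation of `ℤ` that fixes every integer of absolute value larger than `n`
(and hence also fixes `0`). -/

/-- The set of signed permutations of degree `n` (the hyperoctahedral group). -/
def signedPerms (n : ℕ) : Set (Equiv.Perm ℤ) :=
  {σ | (∀ i : ℤ, σ (-i) = -σ i) ∧ ∀ i : ℤ, (n : ℤ) < |i| → σ i = i}

/-- The set of signed permutations of degree `n` with an even number of negative entries in the
one-line notation `σ(1) σ(2) ⋯ σ(n)` (the even hyperoctahedral group, the Weyl group of type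
`D_n`). -/
def evenSignedPerms (n : ℕ) : Set (Equiv.Perm ℤ) :=
  {σ | σ ∈ signedPerms n ∧ Even ((Finset.Icc (1 : ℤ) n).filter (fun i => σ i < 0)).card}

/-- The Coxeter generators `s_0 = (1, -2)(2, -1)` and `s_i = (i, i+1)(-i, -(i+1))` for `i ≥ 1`. -/
def simpleReflection : ℕ → Equiv.Perm ℤ
  | 0 => Equiv.swap 1 (-2) * Equiv.swap 2 (-1)
  | i + 1 => Equiv.swap ((i : ℤ) + 1) ((i : ℤ) + 2) * Equiv.swap (-((i : ℤ) + 1)) (-((i : ℤ) + 2))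

/-! ### The root system of type `D_n`

It is realised in the lattice `ℤⁿ`; coordinates are indexed by `Fin n`, the index `j : Fin n`
standing for the coordinate `j + 1`. -/

/-- The vector `e_k` for `1 ≤ k ≤ n`, extended by `e_{-k} = -e_k`. -/
def e (n : ℕ) (k : ℤ) : Fin n → ℤ := fun j =>
  if k = (j : ℤ) + 1 then 1 else if k = -((j : ℤ) + 1) then -1 else 0

/-- The action of a signed permutation on vectors: the linear map with `e_k ↦ e_{σ(k)}`. -/
def act (n : ℕ) (σ : Equiv.Perm ℤ) (v : Fin n → ℤ) : Fin n → ℤ :=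
  ∑ j : Fin n, v j • e n (σ ((j : ℤ) + 1))

/-- The roots `±(e_i ± e_j)`, `1 ≤ i < j ≤ n`. -/
def roots (n : ℕ) : Set (Fin n → ℤ) :=
  {v | ∃ i j : ℤ, 1 ≤ i ∧ i < j ∧ j ≤ n ∧
    (v = e n i + e n j ∨ v = e n i - e n j ∨ v = -(e n i + e n j) ∨ v = -(e n i - e n j))}

/-- The simple roots `α_0 = e_1 + e_2` and `α_i = e_{i+1} - e_i` for `1 ≤ i ≤ n - 1`. -/
def simpleRoot (n : ℕ) : ℕ → (Fin n → ℤ)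
  | 0 => e n 1 + e n 2
  | i + 1 => e n ((i : ℤ) + 2) - e n ((i : ℤ) + 1)

/-- The positive roots: the roots that are nonnegative combinations of the simple roots. -/
def posRoots (n : ℕ) : Set (Fin n → ℤ) :=
  {v | v ∈ roots n ∧ ∃ c : ℕ → ℤ, (∀ k, 0 ≤ c k) ∧
    v = ∑ k ∈ Finset.range n, c k • simpleRoot n k}

/-- The negative roots, `Φ⁻ = -Φ⁺`. -/
def negRoots (n : ℕ) : Set (Fin n → ℤ) := {v | -v ∈ posRoots n}

/-- `v` has height `h`: the coefficients of `v` with respect to the simple roots sum to `h`.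
(The simple roots are linearly independent when `n ≥ 2`, so the height is unique.) -/
def HasHeight (n : ℕ) (v : Fin n → ℤ) (h : ℤ) : Prop :=
  ∃ c : ℕ → ℤ, v = ∑ k ∈ Finset.range n, c k • simpleRoot n k ∧ h = ∑ k ∈ Finset.range n, c k

/-- The Coxeter length `ℓ(w)`: the number of positive roots sent to negative roots by `w`. -/
def len (n : ℕ) (w : Equiv.Perm ℤ) : ℕ :=
  {v | v ∈ posRoots n ∧ act n w v ∈ negRoots n}.ncard

/-- The odd length `L(w)`: the number of positive roots of odd height sent to negative roots
by `w`. -/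
def oddLen (n : ℕ) (w : Equiv.Perm ℤ) : ℕ :=
  {v | v ∈ posRoots n ∧ (∃ h, HasHeight n v h ∧ Odd h) ∧ act n w v ∈ negRoots n}.ncard

/-! ### Parabolic quotients and the generating function -/

/-- The parabolic quotient `D_n^I = {w ∈ D_n | ℓ(w s_i) > ℓ(w) for all i ∈ I}`. -/
def quotient (n : ℕ) (I : Set ℕ) : Set (Equiv.Perm ℤ) :=
  {w | w ∈ evenSignedPerms n ∧ ∀ i ∈ I, len n w < len n (w * simpleReflection i)}

theorem abs_apply_le {n : ℕ} {σ : Equiv.Perm ℤ} (hσ : σ ∈ signedPerms n) {i : ℤ}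
    (hi : |i| ≤ n) : |σ i| ≤ n := by
  by_contra h
  have h1 := hσ.2 (σ i) (not_le.mp h)
  have h2 : σ i = i := σ.injective h1
  rw [h2] at h
  exact h hi

theorem finite_signedPerms (n : ℕ) : (signedPerms n).Finite := by
  let F : signedPerms n → (Finset.Icc (-(n : ℤ)) n → Finset.Icc (-(n : ℤ)) n) := fun σ i =>
    ⟨σ.1 i.1, Finset.mem_Icc.mpr (abs_le.mp
      (abs_apply_le σ.2 (abs_le.mpr (Finset.mem_Icc.mp i.2))))⟩
  have hF : Function.Injective F := by
    intro σ τ h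
    apply Subtype.ext
    ext i
    by_cases hi : |i| ≤ n
    · exact congrArg Subtype.val (congrFun h ⟨i, Finset.mem_Icc.mpr (abs_le.mp hi)⟩)
    · rw [σ.2.2 i (not_le.mp hi), τ.2.2 i (not_le.mp hi)]
  have : Finite (signedPerms n) := Finite.of_injective F hF
  exact Set.toFinite _

theorem finite_quotient (n : ℕ) (I : Set ℕ) : (quotient n I).Finite :=
  (finite_signedPerms n).subset fun _ h => h.1.1

/-- The sign-twisted generating function `D_n^I(x) = ∑_{w ∈ D_n^I} (-1)^{ℓ(w)} x^{L(w)}`,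
a polynomial with integer coefficients. -/
def genFun (n : ℕ) (I : Set ℕ) : Polynomial ℤ :=
  ∑ w ∈ (finite_quotient n I).toFinset, (-1) ^ len n w * Polynomial.X ^ oddLen n w

/-! ### `q`-multinomial coefficients -/

/-- `[m]_q = (1 - q^m) / (1 - q)`, where `q ≠ 1`. -/
def qInt {K : Type*} [Field K] (q : K) (m : ℕ) : K := (1 - q ^ m) / (1 - q)

/-- `[m]_q! = [1]_q [2]_q ⋯ [m]_q`. -/
def qFactorial {K : Type*} [Field K] (q : K) (m : ℕ) : K := ∏ i ∈ Finset.Icc 1 m, qInt q i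

/-- The `q`-multinomial coefficient `[m]_q! / ([k_1]_q! ⋯ [k_r]_q!)`,
where `k_1 + ⋯ + k_r = m`. -/
def qMultinomial {K : Type*} [Field K] (q : K) (m : ℕ) (ks : List ℕ) : K :=
  qFactorial q m / (ks.map (qFactorial q)).prod

end TypeD

end

/-! ### Signed permutations and roots written as sums e_x + e_y -/

namespace TypeD

/-! Extend e by e_{-k} = -e_k. Every root is then e_x + e_y with |x| ≠ |y|; it is positive exactly
when x + y > 0, its height has the parity of x + y, and w inverts it exactly when also w(x) + w(y) <
0. Hence inversions can be counted over pairs of absolute values of entries of w (`ncard_invSet`).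

Membership in the quotient says that |w(i)| < w(j) for i < j in the first block {1, …, a}, and that
w increases on the second block {a+1, …, n} (`mem_quotient_iff`). Such a w is encoded by colouring
each value v with its place: first block, second block with negative sign, or second block with
positive sign. Only the sign of w(1) is lost, and evenness restores it, so the quotient is in
bijection with the colourings having a values of the first colour. Both statistics can be read off
the colouring: a pair of values contributes a weight depending only on its colours, and, as a and n
are odd, the parity of a position depends only on the colour and on the rank within it.

Deleting the smallest value gives a recursion for the signed generating function with colour counts
(i, j, k), `colGen_succ`. Applied twice, it gives closed forms by induction for an odd number 2m+1
of values (`OddClosedForm`). With q = x², counts (2I+1, 2J, 2L) give (-1)^J x^(J(2I+1+J)) times the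
q-multinomial of m with parts I, J, L, while three odd counts give 0. Summing over J by the
q-binomial theorem gives `sum_colouring_eq`; the product in the theorem takes the same form because
(1 - x^k)(1 + x^k) = 1 - x^(2k). -/

theorem e_neg (n : ℕ) (k : ℤ) : e n (-k) = -e n k := by
  funext j
  simp only [e, Pi.neg_apply]
  split_ifs <;> omega

theorem act_add (n : ℕ) (σ : Equiv.Perm ℤ) (v w : Fin n → ℤ) :
    act n σ (v + w) = act n σ v + act n σ w := by
  simp [act, add_smul, Finset.sum_add_distrib]

theorem act_neg (n : ℕ) (σ : Equiv.Perm ℤ) (v : Fin n → ℤ) :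
    act n σ (-v) = -act n σ v := by
  simp [act]

/-- The target M is arbitrary so that the same evaluation serves both the action (vector values) and
the height (integer values). -/
theorem sum_mul_e {n : ℕ} {M : Type*} [AddCommGroup M] {k : ℤ} (h1 : 1 ≤ k) (h2 : k ≤ n)
    (f : ℤ → M) : ∑ j : Fin n, e n k j • f ((j : ℤ) + 1) = f k := by
  obtain ⟨m, rfl⟩ : ∃ m : ℕ, k = m + 1 := ⟨(k - 1).toNat, by omega⟩
  rw [Finset.sum_eq_single (⟨m, by omega⟩ : Fin n)]
  · simp [e]
  · intro j _ hj
    have hj' : (j : ℤ) ≠ m := fun h => hj (Fin.ext (by simpa using h))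
    have : e n (m + 1) j = 0 := by
      simp only [e]
      split_ifs <;> omega
    simp [this]
  · simp

theorem act_e {n : ℕ} {σ : Equiv.Perm ℤ} (hσ : σ ∈ signedPerms n) {k : ℤ} (h1 : 1 ≤ |k|)
    (h2 : |k| ≤ n) : act n σ (e n k) = e n (σ k) := by
  rcases lt_or_ge k 0 with hk | hk
  · rw [abs_of_neg hk] at h1 h2
    have h := sum_mul_e h1 h2 (fun i => e n (σ i))
    have h' : act n σ (e n (-k)) = e n (σ (-k)) := h
    rwa [e_neg, act_neg, hσ.1, e_neg, neg_inj] at h'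
  · rw [abs_of_nonneg hk] at h1 h2
    exact sum_mul_e h1 h2 (fun i => e n (σ i))

/-- `x` and `y` are nonzero, of distinct absolute values at most `n`; these are the pairs for which
`e_x + e_y` is a root. -/
def IsRootPair (n : ℕ) (x y : ℤ) : Prop :=
  1 ≤ |x| ∧ |x| ≤ n ∧ 1 ≤ |y| ∧ |y| ≤ n ∧ |x| ≠ |y|

theorem IsRootPair.symm {n : ℕ} {x y : ℤ} (h : IsRootPair n x y) : IsRootPair n y x :=
  ⟨h.2.2.1, h.2.2.2.1, h.1, h.2.1, h.2.2.2.2.symm⟩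

theorem IsRootPair.neg {n : ℕ} {x y : ℤ} (h : IsRootPair n x y) : IsRootPair n (-x) (-y) := by
  simpa [IsRootPair] using h

theorem IsRootPair.add_ne_zero {n : ℕ} {x y : ℤ} (h : IsRootPair n x y) : x + y ≠ 0 := by
  intro h0
  apply h.2.2.2.2
  rw [eq_neg_of_add_eq_zero_left h0, abs_neg]

theorem apply_zero {n : ℕ} {σ : Equiv.Perm ℤ} (hσ : σ ∈ signedPerms n) : σ 0 = 0 := by
  have := hσ.1 0
  rw [neg_zero] at this
  omega

theorem inv_mem_signedPerms {n : ℕ} {σ : Equiv.Perm ℤ} (hσ : σ ∈ signedPerms n) :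
    σ⁻¹ ∈ signedPerms n := by
  refine ⟨fun i => ?_, fun i hi => ?_⟩
  · rw [Equiv.Perm.inv_eq_iff_eq, hσ.1]
    simp
  · rw [Equiv.Perm.inv_eq_iff_eq, hσ.2 i hi]

theorem mul_mem_signedPerms {n : ℕ} {σ τ : Equiv.Perm ℤ} (hσ : σ ∈ signedPerms n)
    (hτ : τ ∈ signedPerms n) : σ * τ ∈ signedPerms n := by
  refine ⟨fun i => ?_, fun i hi => ?_⟩
  · simp [hσ.1, hτ.1]
  · simp [hσ.2 i hi, hτ.2 i hi]

theorem abs_apply_eq_iff {n : ℕ} {σ : Equiv.Perm ℤ} (hσ : σ ∈ signedPerms n) {x y : ℤ} :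
    |σ x| = |σ y| ↔ |x| = |y| := by
  rw [abs_eq_abs, abs_eq_abs, ← hσ.1, σ.injective.eq_iff, σ.injective.eq_iff]

theorem one_le_abs_apply {n : ℕ} {σ : Equiv.Perm ℤ} (hσ : σ ∈ signedPerms n) {x : ℤ}
    (hx : 1 ≤ |x|) : 1 ≤ |σ x| := by
  refine Int.one_le_abs fun h => ?_
  rw [σ.injective (h.trans (apply_zero hσ).symm)] at hx
  simp at hx

theorem IsRootPair.map {n : ℕ} {σ : Equiv.Perm ℤ} (hσ : σ ∈ signedPerms n) {x y : ℤ}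
    (h : IsRootPair n x y) : IsRootPair n (σ x) (σ y) :=
  ⟨one_le_abs_apply hσ h.1, abs_apply_le hσ h.2.1, one_le_abs_apply hσ h.2.2.1,
    abs_apply_le hσ h.2.2.2.1, fun h' => h.2.2.2.2 ((abs_apply_eq_iff hσ).1 h')⟩

theorem act_root {n : ℕ} {σ : Equiv.Perm ℤ} (hσ : σ ∈ signedPerms n) {x y : ℤ}
    (h : IsRootPair n x y) : act n σ (e n x + e n y) = e n (σ x) + e n (σ y) := by
  rw [act_add, act_e hσ h.1 h.2.1, act_e hσ h.2.2.1 h.2.2.2.1]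

theorem mem_roots_iff {n : ℕ} {v : Fin n → ℤ} :
    v ∈ roots n ↔ ∃ x y, IsRootPair n x y ∧ v = e n x + e n y := by
  constructor
  · rintro ⟨i, j, hi, hij, hj, h | h | h | h⟩
    · refine ⟨i, j, ?_, h⟩
      rw [IsRootPair, abs_of_pos (by omega), abs_of_pos (by omega)]; omega
    · refine ⟨i, -j, ?_, by rw [h, e_neg]; abel⟩
      rw [IsRootPair, abs_neg, abs_of_pos (by omega), abs_of_pos (by omega)]; omega
    · refine ⟨-i, -j, ?_, by rw [h, e_neg, e_neg]; abel⟩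
      rw [IsRootPair, abs_neg, abs_neg, abs_of_pos (by omega), abs_of_pos (by omega)]; omega
    · refine ⟨-i, j, ?_, by rw [h, e_neg]; abel⟩
      rw [IsRootPair, abs_neg, abs_of_pos (by omega), abs_of_pos (by omega)]; omega
  · rintro ⟨x, y, ⟨hx1, hx2, hy1, hy2, hxy⟩, rfl⟩
    wlog h : |x| < |y| generalizing x y
    · rw [add_comm]
      exact this y x hy1 hy2 hx1 hx2 hxy.symm (by omega)
    refine ⟨|x|, |y|, hx1, h, hy2, ?_⟩
    rcases abs_cases x with ⟨h1, -⟩ | ⟨h1, -⟩ <;> rcases abs_cases y with ⟨h2, -⟩ | ⟨h2, -⟩ <;>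
      rw [h1, h2] <;> simp only [e_neg]
    · simp
    · right; left; abel
    · right; right; right; abel
    · right; right; left; abel

/-! ### Height, positivity and uniqueness of the pair representing a root -/

/-- The linear functional taking the value `1` on every simple root. -/
def ht (n : ℕ) (v : Fin n → ℤ) : ℤ := ∑ j : Fin n, v j * j

theorem ht_add (n : ℕ) (v w : Fin n → ℤ) : ht n (v + w) = ht n v + ht n w := by
  simp [ht, add_mul, Finset.sum_add_distrib]

theorem ht_neg (n : ℕ) (v : Fin n → ℤ) : ht n (-v) = -ht n v := by
  simp [ht]

theorem ht_e_of_pos {n : ℕ} {k : ℤ} (h1 : 1 ≤ k) (h2 : k ≤ n) : ht n (e n k) = k - 1 := by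
  have := sum_mul_e h1 h2 (fun i => i - 1)
  simpa [ht] using this

theorem ht_simpleRoot {n k : ℕ} (hn : 2 ≤ n) (hk : k < n) : ht n (simpleRoot n k) = 1 := by
  cases k with
  | zero => rw [simpleRoot, ht_add, ht_e_of_pos, ht_e_of_pos] <;> omega
  | succ i =>
    rw [simpleRoot, sub_eq_add_neg, ht_add, ht_neg, ht_e_of_pos, ht_e_of_pos] <;> omega

theorem ht_sum_simpleRoot {n : ℕ} (hn : 2 ≤ n) (c : ℕ → ℤ) :
    ht n (∑ k ∈ Finset.range n, c k • simpleRoot n k) = ∑ k ∈ Finset.range n, c k := by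
  have h : ∀ k ∈ Finset.range n, ∑ j : Fin n, c k * (simpleRoot n k j * j) = c k := by
    intro k hk
    rw [← Finset.mul_sum]
    have := ht_simpleRoot hn (Finset.mem_range.1 hk)
    rw [ht] at this
    rw [this, mul_one]
  rw [← Finset.sum_congr rfl h, Finset.sum_comm, ht]
  refine Finset.sum_congr rfl fun j _ => ?_
  simp [Finset.sum_apply, Finset.sum_mul, mul_assoc]

/-- The functional sends e_k to k - sgn k, so it differs from x + y by sgn x + sgn y ∈ {0, ±2},
which keeps the parity. It also keeps the sign: if x and y have equal signs, |x| ≠ |y| forces |x| +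
|y| ≥ 3. -/
theorem ht_root {n : ℕ} {x y : ℤ} (h : IsRootPair n x y) :
    (0 < ht n (e n x + e n y) ↔ 0 < x + y) ∧ (Odd (ht n (e n x + e n y)) ↔ Odd (x + y)) := by
  obtain ⟨h1, h2, h3, h4, h5⟩ := h
  have key : ∀ k : ℤ, 1 ≤ |k| → |k| ≤ n →
      (0 < k ∧ ht n (e n k) = k - 1) ∨ (k < 0 ∧ ht n (e n k) = k + 1) := by
    intro k hk1 hk2
    rcases lt_or_ge k 0 with hk | hk
    · right
      rw [abs_of_neg hk] at hk1 hk2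
      refine ⟨hk, ?_⟩
      rw [← neg_neg k, e_neg, ht_neg, ht_e_of_pos hk1 hk2]
      ring
    · left
      rw [abs_of_nonneg hk] at hk1 hk2
      exact ⟨by omega, ht_e_of_pos hk1 hk2⟩
  rw [ht_add, Int.odd_iff, Int.odd_iff]
  rcases key x h1 h2 with ⟨hx, hx'⟩ | ⟨hx, hx'⟩ <;> rcases key y h3 h4 with ⟨hy, hy'⟩ | ⟨hy, hy'⟩ <;>
    rw [hx', hy'] <;> simp only [abs_of_pos, abs_of_neg, hx, hy] at h5 <;> omega

/-- The nonnegative combinations of the simple roots. -/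
def posCone (n : ℕ) : AddSubmonoid (Fin n → ℤ) where
  carrier := {v | ∃ c : ℕ → ℤ, (∀ k, 0 ≤ c k) ∧ v = ∑ k ∈ Finset.range n, c k • simpleRoot n k}
  zero_mem' := ⟨0, by simp, by simp⟩
  add_mem' := by
    rintro _ _ ⟨c, hc, rfl⟩ ⟨d, hd, rfl⟩
    exact ⟨c + d, fun k => add_nonneg (hc k) (hd k), by simp [add_smul, Finset.sum_add_distrib]⟩

theorem simpleRoot_mem_posCone {n k : ℕ} (hk : k < n) : simpleRoot n k ∈ posCone n := by
  refine ⟨Pi.single k 1, fun i => ?_, ?_⟩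
  · by_cases h : i = k
    · subst h; simp
    · simp [h]
  · rw [Finset.sum_eq_single k]
    · simp
    · intro i _ hi; simp [hi]
    · intro h; exact absurd (Finset.mem_range.2 hk) h

theorem sub_mem_posCone {n : ℕ} {i : ℤ} (hi : 1 ≤ i) (m : ℕ) (h : i + m ≤ n) :
    e n (i + m) - e n i ∈ posCone n := by
  induction m with
  | zero => simp [(posCone n).zero_mem]
  | succ m ih =>
    have h1 := ih (by push_cast at h; omega)
    have h2 : simpleRoot n ((i + m - 1).toNat + 1) ∈ posCone n :=
      simpleRoot_mem_posCone (by push_cast at h; omega)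
    have h3 : (((i + m - 1).toNat : ℕ) : ℤ) = i + m - 1 := by omega
    rw [simpleRoot, h3] at h2
    have := (posCone n).add_mem h2 h1
    convert this using 1
    push_cast
    rw [show i + (m : ℤ) - 1 + 2 = i + (m + 1) by ring, show i + (m : ℤ) - 1 + 1 = i + m by ring]
    abel

/-- A nonnegative combination of simple roots has nonnegative height, which rules out x + y < 0.
Conversely, when x + y > 0 the index of larger absolute value is positive, and differences e_j - e_i
with i ≤ j telescope into simple roots. -/
theorem mem_posRoots_iff {n : ℕ} (hn : 2 ≤ n) {x y : ℤ} (h : IsRootPair n x y) :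
    e n x + e n y ∈ posRoots n ↔ 0 < x + y := by
  constructor
  · rintro ⟨-, c, hc, hv⟩
    have h1 := ht_sum_simpleRoot hn c
    rw [← hv] at h1
    have h2 : 0 ≤ ht n (e n x + e n y) := h1 ▸ Finset.sum_nonneg fun k _ => hc k
    by_contra h3
    have h4 := (ht_root h.neg).1
    rw [e_neg, e_neg, ← neg_add, ht_neg] at h4
    have := h.add_ne_zero
    have := h4.2 (by omega)
    omega
  · intro hxy
    refine ⟨mem_roots_iff.2 ⟨x, y, h, rfl⟩, ?_⟩
    change e n x + e n y ∈ posCone n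
    have sub_mem : ∀ i j : ℤ, 1 ≤ i → i ≤ j → j ≤ n → e n j - e n i ∈ posCone n := by
      intro i j h1 h2 h3
      have := sub_mem_posCone (n := n) h1 (j - i).toNat (by omega)
      rwa [show i + ((j - i).toNat : ℤ) = j by omega] at this
    obtain ⟨h1, h2, h3, h4, h5⟩ := h
    wlog hlt : |x| < |y| generalizing x y
    · rw [add_comm]
      exact this (by omega) h3 h4 h1 h2 h5.symm (by omega)
    have hy : 0 < y := by
      by_contra hy
      rw [abs_of_nonpos (not_lt.1 hy)] at hlt
      have := le_abs_self x
      omega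
    rw [abs_of_pos hy] at h3 h4 hlt
    rcases lt_or_ge x 0 with hx | hx
    · rw [abs_of_neg hx] at *
      have := sub_mem (-x) y (by omega) (by omega) h4
      rwa [e_neg, sub_neg_eq_add, add_comm] at this
    · rw [abs_of_nonneg hx] at *
      -- For 0 < x < y: e_x + e_y = (e_y - e_2) + (e_x - e_1) + (e_1 + e_2).
      have a1 := sub_mem 2 y (by omega) (by omega) h4
      have a2 := sub_mem 1 x (by omega) (by omega) h2
      have a3 := simpleRoot_mem_posCone (n := n) (k := 0) (by omega)
      have := (posCone n).add_mem ((posCone n).add_mem a1 a2) a3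
      convert this using 1
      simp only [simpleRoot]
      abel

theorem exists_odd_height_iff {n : ℕ} (hn : 2 ≤ n) {x y : ℤ} (h : IsRootPair n x y)
    (hxy : 0 < x + y) : (∃ k, HasHeight n (e n x + e n y) k ∧ Odd k) ↔ Odd (x + y) := by
  rw [← (ht_root h).2]
  constructor
  · rintro ⟨k, ⟨c, hc, rfl⟩, hk⟩
    rwa [hc, ht_sum_simpleRoot hn]
  · intro ho
    obtain ⟨-, c, -, hc⟩ := (mem_posRoots_iff hn h).2 hxy
    refine ⟨_, ⟨c, hc, rfl⟩, ?_⟩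
    rwa [hc, ht_sum_simpleRoot hn] at ho

theorem mem_negRoots_iff {n : ℕ} (hn : 2 ≤ n) {x y : ℤ} (h : IsRootPair n x y) :
    e n x + e n y ∈ negRoots n ↔ x + y < 0 := by
  have := mem_posRoots_iff hn h.neg
  rw [e_neg, e_neg, ← neg_add] at this
  rw [negRoots, Set.mem_ofPred_eq, this]
  omega

/-- Compare the coordinate of index |x|: on the left only e_x contributes to it. -/
theorem eq_or_eq_of_e_add_e_eq {n : ℕ} {x y x' y' : ℤ} (h : IsRootPair n x y)
    (heq : e n x + e n y = e n x' + e n y') : x = x' ∨ x = y' := by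
  obtain ⟨h1, h2, -, -, h5⟩ := h
  have h6 : y ≠ x := fun h => h5 (by rw [h])
  have h7 : y ≠ -x := fun h => h5 (by rw [h, abs_neg])
  have ev : ((if x = |x| then 1 else if x = -|x| then -1 else 0) +
      (if y = |x| then 1 else if y = -|x| then -1 else 0) : ℤ) =
      (if x' = |x| then 1 else if x' = -|x| then -1 else 0) +
      (if y' = |x| then 1 else if y' = -|x| then -1 else 0) := by
    have := congrFun heq ⟨(|x| - 1).toNat, by omega⟩
    simp only [e, Pi.add_apply] at this
    rwa [show (((|x| - 1).toNat : ℕ) : ℤ) + 1 = |x| by omega] at this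
  rcases abs_cases x with ⟨a, b⟩ | ⟨a, b⟩ <;> rw [a] at ev h1 <;>
    simp only [neg_neg, h6, h7, if_true, if_false] at ev <;> split_ifs at ev <;> omega

theorem e_add_e_inj {n : ℕ} {x y x' y' : ℤ} (h : IsRootPair n x y)
    (heq : e n x + e n y = e n x' + e n y') : (x = x' ∧ y = y') ∨ (x = y' ∧ y = x') := by
  have h1 := eq_or_eq_of_e_add_e_eq h heq
  have h2 := eq_or_eq_of_e_add_e_eq h.symm ((add_comm _ _).trans heq)
  have h3 : x ≠ y := fun h' => h.2.2.2.2 (by rw [h'])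
  omega

/-! ### Inversions counted by pairs of values -/

/-- The roots `e_x + e_y > 0` made negative by `w` for which `x + y` satisfies `P`. -/
def invSet (n : ℕ) (w : Equiv.Perm ℤ) (P : ℤ → Prop) : Set (Fin n → ℤ) :=
  {v | ∃ x y, IsRootPair n x y ∧ v = e n x + e n y ∧ 0 < x + y ∧ w x + w y < 0 ∧ P (x + y)}

theorem len_eq_ncard_invSet {n : ℕ} (hn : 2 ≤ n) {w : Equiv.Perm ℤ} (hw : w ∈ signedPerms n) :
    len n w = (invSet n w fun _ => True).ncard := by
  rw [len]
  congr 1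
  ext v
  constructor
  · rintro ⟨h1, h2⟩
    obtain ⟨x, y, hxy, rfl⟩ := mem_roots_iff.1 h1.1
    rw [act_root hw hxy, mem_negRoots_iff hn (hxy.map hw)] at h2
    exact ⟨x, y, hxy, rfl, (mem_posRoots_iff hn hxy).1 h1, h2, trivial⟩
  · rintro ⟨x, y, hxy, rfl, h1, h2, -⟩
    refine ⟨(mem_posRoots_iff hn hxy).2 h1, ?_⟩
    rwa [act_root hw hxy, mem_negRoots_iff hn (hxy.map hw)]

theorem oddLen_eq_ncard_invSet {n : ℕ} (hn : 2 ≤ n) {w : Equiv.Perm ℤ} (hw : w ∈ signedPerms n) :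
    oddLen n w = (invSet n w Odd).ncard := by
  rw [oddLen]
  congr 1
  ext v
  constructor
  · rintro ⟨h1, h3, h2⟩
    obtain ⟨x, y, hxy, rfl⟩ := mem_roots_iff.1 h1.1
    rw [act_root hw hxy, mem_negRoots_iff hn (hxy.map hw)] at h2
    have h1 := (mem_posRoots_iff hn hxy).1 h1
    exact ⟨x, y, hxy, rfl, h1, h2, (exists_odd_height_iff hn hxy h1).1 h3⟩
  · rintro ⟨x, y, hxy, rfl, h1, h2, h3⟩
    refine ⟨(mem_posRoots_iff hn hxy).2 h1, (exists_odd_height_iff hn hxy h1).2 h3, ?_⟩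
    rwa [act_root hw hxy, mem_negRoots_iff hn (hxy.map hw)]

open Classical in
/-- The number of `z ∈ {p + q, p - q}` with `z < 0` that satisfy `P`. -/
noncomputable def pairWeight (P : ℤ → Prop) (p q : ℤ) : ℕ :=
  (if p + q < 0 ∧ P (p + q) then 1 else 0) + (if p - q < 0 ∧ P (p - q) then 1 else 0)

/-- Let g = w⁻¹. If w(x) + w(y) < 0, the entry of larger absolute value is negative, say w(x) = -u,
and w(y) = ∓v with 0 < v < u. Then x + y = -(g(u) ± g(v)), so positivity of the root means g(u) ±
g(v) < 0. The two signs are the two terms of `pairWeight`; evenness of P absorbs the global sign. -/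
theorem ncard_invSet {n : ℕ} {w : Equiv.Perm ℤ} (hw : w ∈ signedPerms n) {P : ℤ → Prop}
    (hP : ∀ k, P (-k) ↔ P k) :
    (invSet n w P).ncard = ∑ v : Fin n, ∑ u : Fin n,
      if v < u then pairWeight P (w⁻¹ ((u : ℤ) + 1)) (w⁻¹ ((v : ℤ) + 1)) else 0 := by
  classical
  have hg := inv_mem_signedPerms hw
  set g := w⁻¹ with hg_def
  have hwg : ∀ x, w (g x) = x := fun x => by simp [hg_def]
  have hgw : ∀ x, g (w x) = x := fun x => by simp [hg_def]
  let sg : Bool → ℤ → ℤ := fun s q => if s then q else -q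
  let T : Finset (Fin n × Fin n × Bool) := Finset.univ.filter fun t =>
    t.1 < t.2.1 ∧ (g ((t.2.1 : ℤ) + 1) + sg t.2.2 (g ((t.1 : ℤ) + 1)) < 0 ∧
      P (g ((t.2.1 : ℤ) + 1) + sg t.2.2 (g ((t.1 : ℤ) + 1))))
  let f : Fin n × Fin n × Bool → (Fin n → ℤ) := fun t =>
    e n (-g ((t.2.1 : ℤ) + 1)) + e n (-sg t.2.2 (g ((t.1 : ℤ) + 1)))
  have hsg : ∀ s x, sg s (g x) = g (sg s x) := by
    intro s x
    cases s
    · simp [sg, hg.1]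
    · simp [sg]
  have hpair : ∀ t : Fin n × Fin n × Bool, t.1 < t.2.1 →
      IsRootPair n (-((t.2.1 : ℤ) + 1)) (-sg t.2.2 ((t.1 : ℤ) + 1)) := by
    rintro ⟨v, u, s⟩ h
    have hv := v.2
    have hu := u.2
    have h' : (v : ℕ) < u := h
    have hv' : |(v : ℤ) + 1| = v + 1 := abs_of_pos (by omega)
    have hu' : |(u : ℤ) + 1| = u + 1 := abs_of_pos (by omega)
    cases s <;> simp only [sg, IsRootPair, abs_neg, hv', hu', if_true, Bool.false_eq_true,
      if_false] <;> omega
  have hf : ∀ t, f t = e n (g (-((t.2.1 : ℤ) + 1))) + e n (g (-sg t.2.2 ((t.1 : ℤ) + 1))) := by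
    intro t
    simp only [f, hsg, hg.1]
  have himage : invSet n w P = f '' (T : Set (Fin n × Fin n × Bool)) := by
    ext vec
    constructor
    · rintro ⟨x, y, hxy, rfl, h1, h2, h3⟩
      -- The root determines only the unordered pair {x, y}; order it so that w(x) is the entry of
      -- larger absolute value.
      wlog hlt : |w y| < |w x| generalizing x y
      · rw [add_comm]
        refine this y x hxy.symm (by omega) (by omega) (by rwa [add_comm]) ?_
        have := (hxy.map hw).2.2.2.2
        omega
      have hwx : w x < 0 := by
        by_contra h
        rw [abs_of_nonneg (not_lt.1 h)] at hlt
        have := neg_abs_le (w y)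
        omega
      obtain ⟨b1, b2, b3, b4, b5⟩ := hxy.map hw
      rw [abs_of_neg hwx] at *
      obtain ⟨s, m, hs, hm⟩ : ∃ (s : Bool) (m : ℕ), w y = -sg s ((m : ℤ) + 1) ∧
          |w y| = m + 1 := by
        rcases abs_cases (w y) with ⟨a, b⟩ | ⟨a, b⟩
        · exact ⟨false, (w y - 1).toNat, by simp only [sg, Bool.false_eq_true, if_false]; omega,
            by omega⟩
        · exact ⟨true, (-w y - 1).toNat, by simp only [sg, if_true]; omega, by omega⟩
      obtain ⟨l, hl⟩ : ∃ l : ℕ, -w x = l + 1 := ⟨(-w x - 1).toNat, by omega⟩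
      let t : Fin n × Fin n × Bool := (⟨m, by omega⟩, ⟨l, by omega⟩, s)
      have hx : g (-((l : ℤ) + 1)) = x := by rw [← hl, neg_neg, hgw]
      have hy : g (-sg s ((m : ℤ) + 1)) = y := by rw [← hs, hgw]
      have hsum : g ((l : ℤ) + 1) + sg s (g ((m : ℤ) + 1)) = -(x + y) := by
        rw [hsg, ← hx, ← hy, hg.1, hg.1]
        ring
      refine ⟨t, ?_, ?_⟩
      · rw [Finset.mem_coe, Finset.mem_filter]
        refine ⟨Finset.mem_univ _, Fin.mk_lt_mk.2 (by omega), ?_, ?_⟩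
        · simp only [t, hsum]; omega
        · simp only [t, hsum]; rwa [hP]
      · rw [hf]
        simp only [t, hx, hy]
    · rintro ⟨t, ht, rfl⟩
      rw [Finset.mem_coe, Finset.mem_filter] at ht
      obtain ⟨-, h1, h2, h3⟩ := ht
      rw [hsg] at h2 h3
      refine ⟨_, _, (hpair t h1).map hg, hf t, ?_, ?_, ?_⟩
      · rw [hg.1, hg.1]
        omega
      · rw [hwg, hwg]
        have := (hpair t h1)
        obtain ⟨v, u, s⟩ := t
        have h' : (v : ℕ) < u := h1
        cases s <;> simp only [sg, if_true, Bool.false_eq_true, if_false] <;> omega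
      · rw [hg.1, hg.1, ← neg_add, hP]
        exact h3
  have hinj : Set.InjOn f (T : Set (Fin n × Fin n × Bool)) := by
    intro t ht t' ht' heq
    rw [Finset.mem_coe, Finset.mem_filter] at ht ht'
    have h1 := hpair t ht.2.1
    rw [hf, hf] at heq
    have h2 := e_add_e_inj (h1.map hg) heq
    simp only [g.injective.eq_iff] at h2
    have l1 := ht.2.1
    have l2 := ht'.2.1
    clear h1 heq ht ht' hf hpair himage
    obtain ⟨v, u, s⟩ := t
    obtain ⟨v', u', s'⟩ := t'
    simp only [Prod.mk.injEq, Fin.ext_iff, Fin.lt_def] at *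
    cases s <;> cases s' <;> simp only [sg, if_true, Bool.false_eq_true, if_false, and_true,
      and_false, reduceCtorEq] at * <;> omega
  rw [himage, hinj.ncard_image, Set.ncard_coe_finset, Finset.card_filter,
    Fintype.sum_prod_type]
  refine Finset.sum_congr rfl fun v _ => ?_
  rw [Fintype.sum_prod_type]
  refine Finset.sum_congr rfl fun u _ => ?_
  rw [Fintype.sum_bool]
  by_cases h : v < u
  · simp only [h, true_and, if_true, pairWeight, sg, Bool.false_eq_true, if_false, sub_eq_add_neg]
  · simp [h]

theorem finite_rootPairs (n : ℕ) : {v | ∃ x y, IsRootPair n x y ∧ v = e n x + e n y}.Finite := by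
  refine (((Finset.Icc (-(n : ℤ)) n ×ˢ Finset.Icc (-(n : ℤ)) n).image
    fun p => e n p.1 + e n p.2).finite_toSet).subset ?_
  rintro _ ⟨x, y, h, rfl⟩
  simp only [Finset.coe_image, Set.mem_image, Finset.mem_coe, Finset.mem_product, Finset.mem_Icc]
  exact ⟨(x, y), ⟨abs_le.1 h.2.1, abs_le.1 h.2.2.2.1⟩, rfl⟩

/-! ### Descents and simple reflections -/

/-- The involution s reverses e_p + e_q and, by `hstab`, makes no other positive root negative.
Transported by s, the inversions of ws become the set B below, which differs from the inversion set
of w only in ±(e_p + e_q). The sign of w(p) + w(q) decides which of the two sets is larger. -/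
theorem len_lt_len_mul_iff {n : ℕ} (hn : 2 ≤ n) {w s : Equiv.Perm ℤ} (hw : w ∈ signedPerms n)
    (hs : s ∈ signedPerms n) (hss : ∀ x, s (s x) = x) {p q : ℤ} (hpq : IsRootPair n p q)
    (hp : s p = -q) (hq : s q = -p) (hpos : 0 < p + q)
    (hstab : ∀ x y, IsRootPair n x y → 0 < x + y → s x + s y < 0 →
      (x = p ∧ y = q) ∨ (x = q ∧ y = p)) :
    len n w < len n (w * s) ↔ 0 < w p + w q := by
  rw [len_eq_ncard_invSet hn hw, len_eq_ncard_invSet hn (mul_mem_signedPerms hw hs)]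
  set B : Set (Fin n → ℤ) :=
    {v | ∃ x y, IsRootPair n x y ∧ v = e n x + e n y ∧ 0 < s x + s y ∧ w x + w y < 0} with hB
  have hfinA : (invSet n w fun _ => True).Finite := (finite_rootPairs n).subset
    fun v ⟨x, y, h1, h2, _⟩ => ⟨x, y, h1, h2⟩
  have hfinB : B.Finite := (finite_rootPairs n).subset fun v ⟨x, y, h1, h2, _⟩ => ⟨x, y, h1, h2⟩
  have hcard : (invSet n (w * s) fun _ => True).ncard = B.ncard := by
    have : B = act n s '' invSet n (w * s) fun _ => True := by
      ext v
      constructor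
      · rintro ⟨x, y, hxy, rfl, h1, h2⟩
        refine ⟨e n (s x) + e n (s y), ⟨_, _, hxy.map hs, rfl, h1, ?_, trivial⟩, ?_⟩
        · simpa [hss] using h2
        · rw [act_root hs (hxy.map hs), hss, hss]
      · rintro ⟨_, ⟨x, y, hxy, rfl, h1, h2, -⟩, rfl⟩
        rw [act_root hs hxy]
        exact ⟨_, _, hxy.map hs, rfl, by rwa [hss, hss], h2⟩
    rw [this, Set.InjOn.ncard_image]
    rintro _ ⟨x, y, hxy, rfl, -⟩ _ ⟨x', y', hxy', rfl, -⟩ h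
    have := congrArg (act n s) h
    rwa [act_root hs hxy, act_root hs hxy', act_root hs (hxy.map hs), act_root hs (hxy'.map hs),
      hss, hss, hss, hss] at this
  rw [hcard]
  have hne := (hpq.map hw).add_ne_zero
  constructor
  · intro hlt
    by_contra hle
    refine absurd hlt (not_lt.2 (Set.ncard_le_ncard ?_ hfinA))
    rintro _ ⟨x, y, hxy, rfl, h1, h2⟩
    refine ⟨x, y, hxy, rfl, ?_, h2, trivial⟩
    by_contra h3
    have h4 := hxy.add_ne_zero
    rcases hstab (-x) (-y) hxy.neg (by omega) (by rw [hs.1, hs.1]; omega) with ⟨a, b⟩ | ⟨a, b⟩ <;>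
    · rw [← a, ← b, hw.1, hw.1] at hle
      omega
  · intro hwpq
    refine Set.ncard_lt_ncard (Set.ssubset_iff_subset_ne.2 ⟨?_, ?_⟩) hfinB
    · rintro _ ⟨x, y, hxy, rfl, h1, h2, -⟩
      refine ⟨x, y, hxy, rfl, ?_, h2⟩
      by_contra h3
      have h4 := (hxy.map hs).add_ne_zero
      rcases hstab x y hxy h1 (by omega) with ⟨rfl, rfl⟩ | ⟨rfl, rfl⟩ <;> omega
    · intro heq
      have hmem : e n (-p) + e n (-q) ∈ B :=
        ⟨-p, -q, hpq.neg, rfl, by rw [hs.1, hs.1, hp, hq]; omega, by rw [hw.1, hw.1]; omega⟩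
      rw [← heq] at hmem
      obtain ⟨x, y, hxy, h1, h2, -⟩ := hmem
      rcases e_add_e_inj hpq.neg h1 with ⟨a, b⟩ | ⟨a, b⟩ <;> omega

theorem simpleReflection_zero_apply (x : ℤ) : simpleReflection 0 x =
    if x = 1 then -2 else if x = -2 then 1 else if x = 2 then -1 else if x = -1 then 2 else x := by
  simp only [simpleReflection, Equiv.Perm.mul_apply, Equiv.swap_apply_def]
  split_ifs <;> first | omega | contradiction

theorem simpleReflection_succ_apply (i : ℕ) (x : ℤ) : simpleReflection (i + 1) x =
    if x = i + 1 then (i : ℤ) + 2 else if x = i + 2 then (i : ℤ) + 1 else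
    if x = -(i + 1) then -((i : ℤ) + 2) else if x = -(i + 2) then -((i : ℤ) + 1) else x := by
  simp only [simpleReflection, Equiv.Perm.mul_apply, Equiv.swap_apply_def]
  split_ifs <;> omega

theorem len_lt_len_mul_simpleReflection_zero_iff {n : ℕ} (hn : 2 ≤ n) {w : Equiv.Perm ℤ}
    (hw : w ∈ signedPerms n) :
    len n w < len n (w * simpleReflection 0) ↔ 0 < w 1 + w 2 := by
  refine len_lt_len_mul_iff (p := 1) (q := 2) hn hw ⟨fun x => ?_, fun x hx => ?_⟩ (fun x => ?_) ?_ ?_ ?_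
    (by norm_num) fun x y h1 h2 h3 => ?_
  · simp only [simpleReflection_zero_apply]
    split_ifs <;> omega
  · rw [lt_abs] at hx
    rw [simpleReflection_zero_apply]
    split_ifs <;> omega
  · simp only [simpleReflection_zero_apply]
    split_ifs <;> first | omega | contradiction
  · refine ⟨?_, ?_, ?_, ?_, ?_⟩ <;> norm_num <;> omega
  · simp [simpleReflection_zero_apply]
  · simp [simpleReflection_zero_apply]
  · have h4 : x ≠ y := fun h => h1.2.2.2.2 (by rw [h])
    have h5 : y ≠ 0 := by rintro rfl; simp [IsRootPair] at h1
    have h6 : x ≠ 0 := by rintro rfl; simp [IsRootPair] at h1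
    simp only [simpleReflection_zero_apply] at h3
    split_ifs at h3 <;> omega

theorem len_lt_len_mul_simpleReflection_succ_iff {n : ℕ} {w : Equiv.Perm ℤ}
    (hw : w ∈ signedPerms n) {i : ℕ} (hi : i + 2 ≤ n) :
    len n w < len n (w * simpleReflection (i + 1)) ↔ w (i + 1) < w (i + 2) := by
  have : w (i + 1) < w (i + 2) ↔ 0 < w (i + 2) + w (-(i + 1)) := by
    rw [hw.1]
    omega
  rw [this]
  refine len_lt_len_mul_iff (p := i + 2) (q := -(i + 1)) (by omega) hw ⟨fun x => ?_, fun x hx => ?_⟩ (fun x => ?_) ?_ ?_ ?_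
    (by omega) fun x y h1 h2 h3 => ?_
  · simp only [simpleReflection_succ_apply]
    split_ifs <;> omega
  · rw [lt_abs] at hx
    rw [simpleReflection_succ_apply]
    split_ifs <;> omega
  · simp only [simpleReflection_succ_apply]
    split_ifs <;> omega
  · rw [IsRootPair, abs_neg, abs_of_pos (by omega), abs_of_pos (by omega)]
    omega
  · rw [simpleReflection_succ_apply]
    split_ifs <;> omega
  · rw [simpleReflection_succ_apply]
    split_ifs <;> omega
  · have h4 : x ≠ y := fun h => h1.2.2.2.2 (by rw [h])
    simp only [simpleReflection_succ_apply] at h3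
    split_ifs at h3 <;> omega

/-! ### Colourings and their statistics -/

/-- The possible places of a value `v ∈ {1, …, n}` in the one-line notation of an element of the
parabolic quotient: in the first block, or in the second block with negative or positive sign. -/
inductive Place
  | fst
  | neg
  | pos
  deriving DecidableEq

instance : Fintype Place := ⟨{.fst, .neg, .pos}, by rintro (_ | _ | _) <;> simp⟩

theorem Place.sum_univ {M : Type*} [AddCommMonoid M] (f : Place → M) :
    ∑ p, f p = f .fst + f .neg + f .pos := by
  have : (Finset.univ : Finset Place) = {.fst, .neg, .pos} := rfl
  rw [this, Finset.sum_insert (by simp), Finset.sum_insert (by simp), Finset.sum_singleton,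
    add_assoc]

/-- The number of indices coloured `p`. -/
def count {n : ℕ} (c : Fin n → Place) (p : Place) : ℕ := ∑ u, if c u = p then 1 else 0

/-- The number of larger indices with the same colour. -/
def rank {n : ℕ} (c : Fin n → Place) (v : Fin n) : ℕ :=
  ∑ u, if v < u ∧ c u = c v then 1 else 0

/-- The contribution to the length of a pair of values, the larger one in place `p` and the
smaller one in place `q`. -/
def placeWeight : Place → Place → ℕ
  | .neg, .fst => 2
  | _, .fst => 0
  | .pos, _ => 0
  | _, _ => 1

/-- The parity of the position of the value of rank `t` in place `p`. -/
def parity : Place → ℕ → ℕ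
  | .neg, t => t
  | _, t => t + 1

/-- The length of the element of the parabolic quotient encoded by `c`. -/
def colLen {n : ℕ} (c : Fin n → Place) : ℕ :=
  ∑ v, ∑ u, if v < u then placeWeight (c u) (c v) else 0

/-- The odd length of the element of the parabolic quotient encoded by `c`. -/
def colOddLen {n : ℕ} (c : Fin n → Place) : ℕ :=
  ∑ v, ∑ u, if v < u then
    if Odd (parity (c u) (rank c u) + parity (c v) (rank c v)) then placeWeight (c u) (c v) else 0
  else 0

/-! ### Effect of a new smallest value -/

section Cons

variable {n : ℕ} (p : Place) (c : Fin n → Place)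

theorem count_cons (q : Place) :
    count (Fin.cons p c : Fin (n + 1) → Place) q = (if p = q then 1 else 0) + count c q := by
  simp only [count, Fin.sum_univ_succ, Fin.cons_zero, Fin.cons_succ]

theorem rank_cons_zero : rank (Fin.cons p c : Fin (n + 1) → Place) 0 = count c p := by
  simp only [count, rank, Fin.sum_univ_succ, Fin.cons_zero, Fin.cons_succ]
  simp

/-- Ranks count larger indices only, so a new smallest index does not disturb the old ones. This is
why the recursion removes the smallest value. -/
theorem rank_cons_succ (v : Fin n) :
    rank (Fin.cons p c : Fin (n + 1) → Place) v.succ = rank c v := by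
  simp only [rank, Fin.sum_univ_succ, Fin.cons_zero, Fin.cons_succ]
  simp

/-- Within each colour q the ranks are 0, 1, …, `count c q - 1`, each taken once. -/
theorem sum_place_rank {M : Type*} [AddCommMonoid M] (f : Place → ℕ → M) :
    ∑ u, f (c u) (rank c u) = ∑ q, ∑ t ∈ Finset.range (count c q), f q t := by
  induction n with
  | zero => simp [count]
  | succ n ih =>
    rw [← Fin.cons_self_tail c]
    generalize c 0 = p
    generalize Fin.tail c = d
    rw [Fin.sum_univ_succ]
    simp only [Fin.cons_zero, Fin.cons_succ, rank_cons_zero, rank_cons_succ, count_cons]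
    rw [ih, Place.sum_univ, Place.sum_univ]
    cases p <;> simp [add_comm 1, Finset.sum_range_succ] <;> abel

theorem colLen_cons : colLen (Fin.cons p c : Fin (n + 1) → Place) =
    ∑ q, count c q * placeWeight q p + colLen c := by
  have h := sum_place_rank c fun q _ => placeWeight q p
  simp only [Finset.sum_const, Finset.card_range, smul_eq_mul] at h
  rw [← h]
  simp [colLen, Fin.sum_univ_succ]

theorem colOddLen_cons : colOddLen (Fin.cons p c : Fin (n + 1) → Place) =
    ∑ q, (∑ t ∈ Finset.range (count c q), if Odd (parity q t + parity p (count c p)) then 1 else 0) *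
      placeWeight q p + colOddLen c := by
  have h := sum_place_rank c fun q t =>
    if Odd (parity q t + parity p (count c p)) then placeWeight q p else 0
  simp only [Finset.sum_mul, ite_mul, one_mul, zero_mul]
  rw [← h]
  simp [colOddLen, Fin.sum_univ_succ, rank_cons_zero, rank_cons_succ]

end Cons

/-- The number of `t < n` with `t ≡ p` modulo `2`. -/
def half (n p : ℕ) : ℕ := (n + 1 - p % 2) / 2

/-- The hypothesis says that `parity q t + s` is odd exactly when t ≡ p modulo 2. -/
theorem sum_range_odd_parity {q : Place} {s : ℕ} (n p : ℕ)
    (h : ∀ t, (parity q t + s) % 2 = (t + p + 1) % 2) :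
    ∑ t ∈ Finset.range n, (if Odd (parity q t + s) then 1 else 0) = half n p := by
  induction n with
  | zero => simp [half]; omega
  | succ n ih =>
    have := h n
    rw [Finset.sum_range_succ, ih, half, half]
    split_ifs with h <;> rw [Nat.odd_iff] at h <;> omega

/-! ### The recursion for the signed generating function -/

section GeneratingFunction

variable {K : Type*} [Field K] (x : K)

/-- The signed generating function of the colourings with prescribed colour counts. -/
def colGen (n i j k : ℕ) : K :=
  ∑ c : Fin n → Place, if count c .fst = i ∧ count c .neg = j ∧ count c .pos = k then
    (-1) ^ colLen c * x ^ colOddLen c else 0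

/-- The function `f` shifted by one, extended by zero. -/
def shift {M : Type*} [Zero M] (f : ℕ → M) : ℕ → M
  | 0 => 0
  | i + 1 => f i

theorem shift_two_mul {M : Type*} [Zero M] (f : ℕ → M) (i : ℕ) :
    shift f (2 * i) = shift (fun i => f (2 * i + 1)) i := by
  cases i <;> rfl

theorem sum_cons {n : ℕ} {M : Type*} [AddCommMonoid M] (f : (Fin (n + 1) → Place) → M) :
    ∑ c, f c = ∑ p, ∑ c : Fin n → Place, f (Fin.cons p c) := by
  rw [← (Fin.consEquiv fun _ : Fin (n + 1) => Place).sum_comp, Fintype.sum_prod_type]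
  rfl

theorem colGen_zero : colGen x 0 0 0 0 = 1 := by
  simp [colGen, count, colLen, colOddLen]

/-- Split by the colour of the smallest value. In the first block it has weight 2 with each negative
value, hence no sign; in the second block, with either sign, it has weight 1 with each first-block
and each negative value, hence the sign (-1)^(i+j). The `half` exponents count those partners whose
position has the opposite parity. -/
theorem colGen_succ (n i j k : ℕ) : colGen x (n + 1) i j k =
    shift (fun i => x ^ (2 * half j i) * colGen x n i j k) i +
    shift (fun j => (-1) ^ (i + j) * x ^ (half i j + half j (j + 1)) * colGen x n i j k) j +
    shift (fun k => (-1) ^ (i + j) * x ^ (half i (k + 1) + half j k) * colGen x n i j k) k := by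
  rw [colGen, sum_cons, Place.sum_univ]
  simp only [count_cons, colLen_cons, colOddLen_cons, Place.sum_univ, placeWeight]
  congr 1
  · congr 1
    · rcases i with _ | i
      · simp [shift]
      · simp only [shift, colGen, Finset.mul_sum]
        refine Finset.sum_congr rfl fun c _ => ?_
        by_cases h : count c .fst = i ∧ count c .neg = j ∧ count c .pos = k
        · obtain ⟨rfl, rfl, rfl⟩ := h
          rw [sum_range_odd_parity (q := .neg) (count c .neg) (count c .fst)
            (by simp only [parity]; omega)]
          simp [add_comm 1, pow_add, pow_mul, mul_comm _ 2]
          ring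
        · rw [if_neg (by simpa [add_comm 1] using h), if_neg h, mul_zero]
    · rcases j with _ | j
      · simp [shift]
      · simp only [shift, colGen, Finset.mul_sum]
        refine Finset.sum_congr rfl fun c _ => ?_
        by_cases h : count c .fst = i ∧ count c .neg = j ∧ count c .pos = k
        · obtain ⟨rfl, rfl, rfl⟩ := h
          rw [sum_range_odd_parity (q := .fst) (count c .fst) (count c .neg)
            (by simp only [parity]; omega), sum_range_odd_parity (q := .neg) (count c .neg)
            (count c .neg + 1) (by simp only [parity]; omega)]
          simp [add_comm 1, pow_add]
          ring
        · rw [if_neg (by simpa [add_comm 1] using h), if_neg h, mul_zero]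
  · rcases k with _ | k
    · simp [shift]
    · simp only [shift, colGen, Finset.mul_sum]
      refine Finset.sum_congr rfl fun c _ => ?_
      by_cases h : count c .fst = i ∧ count c .neg = j ∧ count c .pos = k
      · obtain ⟨rfl, rfl, rfl⟩ := h
        rw [sum_range_odd_parity (q := .fst) (count c .fst) (count c .pos + 1)
          (by simp only [parity]; omega), sum_range_odd_parity (q := .neg) (count c .neg)
          (count c .pos) (by simp only [parity]; omega)]
        simp [add_comm 1, pow_add]
        ring
      · rw [if_neg (by simpa [add_comm 1] using h), if_neg h, mul_zero]

end GeneratingFunction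

/-! ### Closed forms by parity of the colour counts -/

section ClosedForm

variable {K : Type*} [Field K] (x : K)

theorem half_two_mul (n p : ℕ) : half (2 * n) p = n := by
  rw [half]; omega

theorem half_odd_even (n p : ℕ) : half (2 * n + 1) (2 * p) = n + 1 := by
  rw [half]; omega

theorem half_odd_odd (n p : ℕ) : half (2 * n + 1) (2 * p + 1) = n := by
  rw [half]; omega

theorem half_odd_even' (n p : ℕ) : half (2 * n + 1) (2 * p + 1 + 1) = n + 1 :=
  half_odd_even n (p + 1)

theorem neg_one_pow_even_odd (i j : ℕ) : (-1 : K) ^ (2 * i + (2 * j + 1)) = -1 :=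
  Odd.neg_one_pow ⟨i + j, by ring⟩

theorem neg_one_pow_odd_even (i j : ℕ) : (-1 : K) ^ (2 * i + 1 + 2 * j) = -1 :=
  Odd.neg_one_pow ⟨i + j, by ring⟩

theorem neg_one_pow_odd_odd (i j : ℕ) : (-1 : K) ^ (2 * i + 1 + (2 * j + 1)) = 1 :=
  Even.neg_one_pow ⟨i + j + 1, by ring⟩

theorem neg_one_pow_even_even (i j : ℕ) : (-1 : K) ^ (2 * i + 2 * j) = 1 :=
  Even.neg_one_pow ⟨i + j, by ring⟩

theorem shift_succ {M : Type*} [Zero M] (f : ℕ → M) (i : ℕ) : shift f (i + 1) = f i := rfl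

theorem shift_zero {M : Type*} [Zero M] (f : ℕ → M) : shift f 0 = 0 := rfl

section OneStep

variable (n I J L : ℕ)

/-- Once parities are fixed, signs and `half` become explicit. Seven of the eight parity classes are
expanded; (even, odd, even) is not needed, since its occurrences cancel in the induction. -/
theorem colGen_succ_odd_even_even : colGen x (n + 1) (2 * I + 1) (2 * J) (2 * L) =
    x ^ (2 * J) * colGen x n (2 * I) (2 * J) (2 * L) +
    shift (fun j => x ^ (I + j + 1) * colGen x n (2 * I + 1) (2 * j + 1) (2 * L)) J -
    shift (fun l => x ^ (I + J + 1) * colGen x n (2 * I + 1) (2 * J) (2 * l + 1)) L := by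
  rw [colGen_succ]
  simp only [shift_two_mul, shift_succ, half_two_mul, half_odd_odd, half_odd_even',
    neg_one_pow_odd_even, neg_one_pow_odd_odd]
  cases J <;> cases L <;> simp only [shift_succ, shift_zero] <;> ring

theorem colGen_succ_even_even_even : colGen x (n + 1) (2 * I) (2 * J) (2 * L) =
    shift (fun i => x ^ (2 * J) * colGen x n (2 * i + 1) (2 * J) (2 * L)) I -
    shift (fun j => x ^ (I + j + 1) * colGen x n (2 * I) (2 * j + 1) (2 * L)) J +
    shift (fun l => x ^ (I + J) * colGen x n (2 * I) (2 * J) (2 * l + 1)) L := by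
  rw [colGen_succ]
  simp only [shift_two_mul, half_two_mul, half_odd_even',
    neg_one_pow_even_odd, neg_one_pow_even_even]
  cases J <;> simp only [shift_succ, shift_zero] <;> ring_nf

theorem colGen_succ_odd_odd_even : colGen x (n + 1) (2 * I + 1) (2 * J + 1) (2 * L) =
    x ^ (2 * J + 2) * colGen x n (2 * I) (2 * J + 1) (2 * L) -
    x ^ (I + J + 1) * colGen x n (2 * I + 1) (2 * J) (2 * L) +
    shift (fun l => x ^ (I + J + 1) * colGen x n (2 * I + 1) (2 * J + 1) (2 * l + 1)) L := by
  rw [colGen_succ]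
  simp only [shift_two_mul, shift_succ, half_two_mul, half_odd_even, half_odd_odd, half_odd_even',
    neg_one_pow_odd_even, neg_one_pow_odd_odd]
  cases L <;> simp only [shift_succ, shift_zero] <;> ring

theorem colGen_succ_even_even_odd : colGen x (n + 1) (2 * I) (2 * J) (2 * L + 1) =
    shift (fun i => x ^ (2 * J) * colGen x n (2 * i + 1) (2 * J) (2 * L + 1)) I -
    shift (fun j => x ^ (I + j + 1) * colGen x n (2 * I) (2 * j + 1) (2 * L + 1)) J +
    x ^ (I + J) * colGen x n (2 * I) (2 * J) (2 * L) := by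
  rw [colGen_succ]
  simp only [shift_two_mul, shift_succ, half_two_mul, half_odd_even',
    neg_one_pow_even_odd, neg_one_pow_even_even]
  cases J <;> simp only [shift_succ, shift_zero] <;> ring

theorem colGen_succ_even_odd_odd : colGen x (n + 1) (2 * I) (2 * J + 1) (2 * L + 1) =
    shift (fun i => x ^ (2 * J) * colGen x n (2 * i + 1) (2 * J + 1) (2 * L + 1)) I +
    x ^ (I + J) * colGen x n (2 * I) (2 * J) (2 * L + 1) -
    x ^ (I + J + 1) * colGen x n (2 * I) (2 * J + 1) (2 * L) := by
  rw [colGen_succ]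
  simp only [shift_two_mul, shift_succ, half_two_mul, half_odd_even, half_odd_odd, neg_one_pow_even_odd, neg_one_pow_even_even]
  ring

theorem colGen_succ_odd_odd_odd : colGen x (n + 1) (2 * I + 1) (2 * J + 1) (2 * L + 1) =
    x ^ (2 * J + 2) * colGen x n (2 * I) (2 * J + 1) (2 * L + 1) -
    x ^ (I + J + 1) * colGen x n (2 * I + 1) (2 * J) (2 * L + 1) +
    x ^ (I + J + 1) * colGen x n (2 * I + 1) (2 * J + 1) (2 * L) := by
  rw [colGen_succ]
  simp only [shift_succ, half_two_mul, half_odd_even, half_odd_odd, neg_one_pow_odd_even, neg_one_pow_odd_odd]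
  ring

theorem colGen_succ_odd_even_odd : colGen x (n + 1) (2 * I + 1) (2 * J) (2 * L + 1) =
    x ^ (2 * J) * colGen x n (2 * I) (2 * J) (2 * L + 1) +
    shift (fun j => x ^ (I + j + 1) * colGen x n (2 * I + 1) (2 * j + 1) (2 * L + 1)) J -
    x ^ (I + J) * colGen x n (2 * I + 1) (2 * J) (2 * L) := by
  rw [colGen_succ]
  simp only [shift_two_mul, shift_succ, half_two_mul, half_odd_odd, half_odd_even',
    neg_one_pow_odd_even, neg_one_pow_odd_odd]
  cases J <;> simp only [shift_succ, shift_zero] <;> ring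

end OneStep

/-- The product `∏_{t = 1}^m (1 - q^t)`. -/
def qProd (q : K) (m : ℕ) : K := ∏ t ∈ Finset.range m, (1 - q ^ (t + 1))

theorem qProd_succ (q : K) (m : ℕ) : qProd q (m + 1) = qProd q m * (1 - q ^ (m + 1)) :=
  Finset.prod_range_succ _ _

theorem qProd_ne_zero {q : K} (hq : ∀ t, q ^ (t + 1) ≠ 1) (m : ℕ) : qProd q m ≠ 0 :=
  Finset.prod_ne_zero_iff.2 fun t _ => sub_ne_zero.2 (hq t).symm

/-- Closed forms for the generating functions of colourings of an odd number `2 m + 1` of values,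
by parity of the colour counts. -/
structure OddClosedForm (m : ℕ) : Prop where
  odd_even_even : ∀ I J L, I + J + L = m → colGen x (2 * m + 1) (2 * I + 1) (2 * J) (2 * L) *
    (qProd (x ^ 2) I * qProd (x ^ 2) J * qProd (x ^ 2) L) =
      (-1) ^ J * x ^ (J * (2 * I + 1 + J)) * qProd (x ^ 2) m
  even_even_odd : ∀ I J L, I + J + L = m → colGen x (2 * m + 1) (2 * I) (2 * J) (2 * L + 1) *
    (qProd (x ^ 2) I * qProd (x ^ 2) J * qProd (x ^ 2) L) =
      (-1) ^ J * x ^ (I + J * (2 * I + J)) * qProd (x ^ 2) m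
  odd_odd_odd : ∀ I J L, I + J + L + 1 = m →
    colGen x (2 * m + 1) (2 * I + 1) (2 * J + 1) (2 * L + 1) = 0

variable {x}

/-- Removing a negative value leads to three odd counts, hence to 0; the two remaining terms have
equal closed forms and opposite signs. -/
theorem OddClosedForm.odd_even_odd {m : ℕ} (hq : ∀ t, (x ^ 2) ^ (t + 1) ≠ 1)
    (h : OddClosedForm x m) {I J L : ℕ} (hm : I + J + L = m) :
    colGen x (2 * m + 2) (2 * I + 1) (2 * J) (2 * L + 1) = 0 := by
  have hI := qProd_ne_zero hq I
  have hJ := qProd_ne_zero hq J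
  have hL := qProd_ne_zero hq L
  refine (mul_eq_zero.1 ?_).resolve_right (mul_ne_zero (mul_ne_zero hI hJ) hL)
  have h0 : shift (fun j => x ^ (I + j + 1) *
      colGen x (2 * m + 1) (2 * I + 1) (2 * j + 1) (2 * L + 1)) J = 0 := by
    cases J with
    | zero => rfl
    | succ j => rw [shift_succ, h.odd_odd_odd I j L (by omega), mul_zero]
  rw [colGen_succ_odd_even_odd, h0]
  linear_combination x ^ (2 * J) * h.even_even_odd I J L hm -
    x ^ (I + J) * h.odd_even_even I J L hm

/-- Two steps of the recursion lead from 2m+3 values to 2m+1. In `hA`, `hP` and `hN` the common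
denominators are cleared, so that each contribution is the expected answer for m times an elementary
factor. -/
theorem OddClosedForm.succ {m : ℕ} (hq : ∀ t, (x ^ 2) ^ (t + 1) ≠ 1) (h : OddClosedForm x m) :
    OddClosedForm x (m + 1) where
  odd_even_even I J L hm := by
    have hA : shift (fun i => x ^ (2 * J) * colGen x (2 * m + 1) (2 * i + 1) (2 * J) (2 * L)) I *
        (qProd (x ^ 2) I * qProd (x ^ 2) J * qProd (x ^ 2) L) * x ^ (2 * J) =
        (-1) ^ J * x ^ (J * (2 * I + 1 + J)) * qProd (x ^ 2) m * (x ^ (2 * J) * (1 - x ^ (2 * I))) := by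
      cases I with
      | zero => simp [shift]
      | succ i =>
        rw [shift_succ, qProd_succ]
        linear_combination x ^ (4 * J) * (1 - (x ^ 2) ^ (i + 1)) * h.odd_even_even i J L (by omega)
    have hP : shift (fun l => x ^ (I + J) * colGen x (2 * m + 1) (2 * I) (2 * J) (2 * l + 1)) L *
        (qProd (x ^ 2) I * qProd (x ^ 2) J * qProd (x ^ 2) L) * x ^ (2 * J) =
        (-1) ^ J * x ^ (J * (2 * I + 1 + J)) * qProd (x ^ 2) m *
          (x ^ (2 * I + 2 * J) * (1 - x ^ (2 * L))) := by
      cases L with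
      | zero => simp [shift]
      | succ l =>
        rw [shift_succ, qProd_succ]
        linear_combination x ^ (I + 3 * J) * (1 - (x ^ 2) ^ (l + 1)) *
          h.even_even_odd I J l (by omega)
    -- The unknown class (2I, 2j+1, 2L) is reached in two ways, removing a first-block and a
    -- negative value in either order. The two terms cancel, leaving only known closed forms.
    have hN : (shift (fun j => x ^ (I + j + 1) *
          colGen x (2 * m + 2) (2 * I + 1) (2 * j + 1) (2 * L)) J -
        x ^ (2 * J) * shift (fun j => x ^ (I + j + 1) *
          colGen x (2 * m + 1) (2 * I) (2 * j + 1) (2 * L)) J) *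
        (qProd (x ^ 2) I * qProd (x ^ 2) J * qProd (x ^ 2) L) =
        (-1) ^ J * x ^ (J * (2 * I + 1 + J)) * qProd (x ^ 2) m * (1 - x ^ (2 * J)) := by
      cases J with
      | zero => simp [shift]
      | succ j =>
        have h0 : shift (fun l => x ^ (I + j + 1) *
            colGen x (2 * m + 1) (2 * I + 1) (2 * j + 1) (2 * l + 1)) L = 0 := by
          cases L with
          | zero => rfl
          | succ l => rw [shift_succ, h.odd_odd_odd I j l (by omega), mul_zero]
        rw [shift_succ, shift_succ, colGen_succ_odd_odd_even, h0, qProd_succ]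
        linear_combination -x ^ (2 * I + 2 * j + 2) * (1 - (x ^ 2) ^ (j + 1)) *
          h.odd_even_even I j L (by omega)
    have h0 : shift (fun l => x ^ (I + J + 1) *
        colGen x (2 * m + 2) (2 * I + 1) (2 * J) (2 * l + 1)) L = 0 := by
      cases L with
      | zero => rfl
      | succ l => rw [shift_succ, h.odd_even_odd hq (by omega), mul_zero]
    rw [show 2 * (m + 1) + 1 = 2 * m + 2 + 1 by ring, colGen_succ_odd_even_even, h0,
      colGen_succ_even_even_even, qProd_succ]
    have hm' : x ^ (2 * (m + 1)) = x ^ (2 * I) * x ^ (2 * J) * x ^ (2 * L) := by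
      rw [← hm]; ring
    rw [← pow_mul, hm']
    -- The factors telescope: x^(2J)(1 - x^(2I)) + x^(2I+2J)(1 - x^(2L)) + (1 - x^(2J)) = 1 -
    -- x^(2I+2J+2L).
    linear_combination hA + hP + hN
  even_even_odd I J L hm := by
    have hA : shift (fun i => x ^ (2 * J) * colGen x (2 * m + 1) (2 * i + 1) (2 * J) (2 * L)) I *
        (qProd (x ^ 2) I * qProd (x ^ 2) J * qProd (x ^ 2) L) * x ^ (I + J) =
        (-1) ^ J * x ^ (I + J * (2 * I + J)) * qProd (x ^ 2) m *
          (x ^ (2 * J) * (1 - x ^ (2 * I))) := by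
      cases I with
      | zero => simp [shift]
      | succ i =>
        rw [shift_succ, qProd_succ]
        linear_combination x ^ (i + 1 + 3 * J) * (1 - (x ^ 2) ^ (i + 1)) *
          h.odd_even_even i J L (by omega)
    have hP : shift (fun l => x ^ (I + J) * colGen x (2 * m + 1) (2 * I) (2 * J) (2 * l + 1)) L *
        (qProd (x ^ 2) I * qProd (x ^ 2) J * qProd (x ^ 2) L) * x ^ (I + J) =
        (-1) ^ J * x ^ (I + J * (2 * I + J)) * qProd (x ^ 2) m *
          (x ^ (2 * I + 2 * J) * (1 - x ^ (2 * L))) := by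
      cases L with
      | zero => simp [shift]
      | succ l =>
        rw [shift_succ, qProd_succ]
        linear_combination x ^ (2 * I + 2 * J) * (1 - (x ^ 2) ^ (l + 1)) *
          h.even_even_odd I J l (by omega)
    -- The unknown class (2I, 2j+1, 2L) again arises twice and cancels, now from removing a negative
    -- and a positive value in either order.
    have hN : (-shift (fun j => x ^ (I + j + 1) *
          colGen x (2 * m + 2) (2 * I) (2 * j + 1) (2 * L + 1)) J -
        x ^ (I + J) * shift (fun j => x ^ (I + j + 1) *
          colGen x (2 * m + 1) (2 * I) (2 * j + 1) (2 * L)) J) *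
        (qProd (x ^ 2) I * qProd (x ^ 2) J * qProd (x ^ 2) L) =
        (-1) ^ J * x ^ (I + J * (2 * I + J)) * qProd (x ^ 2) m * (1 - x ^ (2 * J)) := by
      cases J with
      | zero => simp [shift]
      | succ j =>
        have h0 : shift (fun i => x ^ (2 * j) *
            colGen x (2 * m + 1) (2 * i + 1) (2 * j + 1) (2 * L + 1)) I = 0 := by
          cases I with
          | zero => rfl
          | succ i => rw [shift_succ, h.odd_odd_odd i j L (by omega), mul_zero]
        rw [shift_succ, shift_succ, colGen_succ_even_odd_odd, h0, qProd_succ]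
        linear_combination -x ^ (2 * I + 2 * j + 1) * (1 - (x ^ 2) ^ (j + 1)) *
          h.even_even_odd I j L (by omega)
    have h0 : shift (fun i => x ^ (2 * J) *
        colGen x (2 * m + 2) (2 * i + 1) (2 * J) (2 * L + 1)) I = 0 := by
      cases I with
      | zero => rfl
      | succ i => rw [shift_succ, h.odd_even_odd hq (by omega), mul_zero]
    rw [show 2 * (m + 1) + 1 = 2 * m + 2 + 1 by ring, colGen_succ_even_even_odd, h0,
      colGen_succ_even_even_even, qProd_succ]
    have hm' : x ^ (2 * (m + 1)) = x ^ (2 * I) * x ^ (2 * J) * x ^ (2 * L) := by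
      rw [← hm]; ring
    rw [← pow_mul, hm']
    linear_combination hA + hP + hN
  odd_odd_odd I J L hm := by
    have hI := qProd_ne_zero hq I
    have hJ := qProd_ne_zero hq J
    have hL := qProd_ne_zero hq L
    refine (mul_eq_zero.1 ?_).resolve_right (mul_ne_zero (mul_ne_zero hI hJ) hL)
    have h0 : shift (fun i => x ^ (2 * J) *
        colGen x (2 * m + 1) (2 * i + 1) (2 * J + 1) (2 * L + 1)) I = 0 := by
      cases I with
      | zero => rfl
      | succ i => rw [shift_succ, h.odd_odd_odd i J L (by omega), mul_zero]
    have h1 : shift (fun l => x ^ (I + J + 1) *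
        colGen x (2 * m + 1) (2 * I + 1) (2 * J + 1) (2 * l + 1)) L = 0 := by
      cases L with
      | zero => rfl
      | succ l => rw [shift_succ, h.odd_odd_odd I J l (by omega), mul_zero]
    rw [show 2 * (m + 1) + 1 = 2 * m + 2 + 1 by ring, colGen_succ_odd_odd_odd,
      h.odd_even_odd hq (by omega), colGen_succ_even_odd_odd, colGen_succ_odd_odd_even, h0, h1]
    -- The class (2I, 2J+1, 2L) cancels as before; the two closed forms left carry the same power of
    -- x with opposite signs.
    linear_combination x ^ (I + 3 * J + 2) * h.even_even_odd I J L (by omega) -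
      x ^ (2 * I + 2 * J + 2) * h.odd_even_even I J L (by omega)

theorem oddClosedForm_zero : OddClosedForm x 0 where
  odd_even_even I J L hm := by
    obtain ⟨rfl, rfl, rfl⟩ : I = 0 ∧ J = 0 ∧ L = 0 := by omega
    have := colGen_succ_odd_even_even x 0 0 0 0
    simpa [shift, qProd, colGen_zero] using this
  even_even_odd I J L hm := by
    obtain ⟨rfl, rfl, rfl⟩ : I = 0 ∧ J = 0 ∧ L = 0 := by omega
    have := colGen_succ_even_even_odd x 0 0 0 0
    simpa [shift, qProd, colGen_zero] using this
  odd_odd_odd I J L hm := by omega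

theorem oddClosedForm (hq : ∀ t, (x ^ 2) ^ (t + 1) ≠ 1) (m : ℕ) : OddClosedForm x m := by
  induction m with
  | zero => exact oddClosedForm_zero
  | succ m ih => exact ih.succ hq

/-! ### Gaussian binomials and the q-binomial theorem -/

/-- The Gaussian binomial coefficients. -/
def gaussBinom (q : K) : ℕ → ℕ → K
  | _, 0 => 1
  | 0, _ + 1 => 0
  | s + 1, j + 1 => q ^ (j + 1) * gaussBinom q s (j + 1) + gaussBinom q s j

theorem gaussBinom_eq_zero (q : K) : ∀ {s j : ℕ}, s < j → gaussBinom q s j = 0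
  | 0, j + 1, _ => rfl
  | s + 1, j + 1, h => by
    rw [gaussBinom, gaussBinom_eq_zero q (by omega), gaussBinom_eq_zero q (by omega)]
    ring

theorem gaussBinom_self (q : K) (s : ℕ) : gaussBinom q s s = 1 := by
  induction s with
  | zero => rfl
  | succ s ih => rw [gaussBinom, ih, gaussBinom_eq_zero q (by omega)]; ring

/-- The Pascal recursion matches q^(j+1)(1 - q^(l+1)) + (1 - q^(j+1)) = 1 - q^(j+l+2). -/
theorem gaussBinom_mul_qProd (q : K) (j l : ℕ) :
    gaussBinom q (j + l) j * (qProd q j * qProd q l) = qProd q (j + l) := by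
  induction h : j + l generalizing j l with
  | zero =>
    obtain ⟨rfl, rfl⟩ : j = 0 ∧ l = 0 := by omega
    simp [gaussBinom, qProd]
  | succ s ih =>
    rcases j with _ | j
    · obtain rfl : l = s + 1 := by omega
      simp [gaussBinom, qProd]
    · rcases l with _ | l
      · obtain rfl : j = s := by omega
        rw [gaussBinom_self]
        simp [qProd]
      · rw [gaussBinom, qProd_succ q s]
        have h1 := ih (j + 1) l (by omega)
        have h2 := ih j (l + 1) (by omega)
        obtain rfl : s = j + l + 1 := by omega
        rw [qProd_succ] at h1 h2
        rw [qProd_succ q j, qProd_succ q l]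
        linear_combination q ^ (j + 1) * (1 - q ^ (l + 1)) * h1 + (1 - q ^ (j + 1)) * h2

/-- This is the q-binomial theorem. Splitting off the factor 1 - zq leaves the shorter product at
zq, so the induction keeps z general. -/
theorem prod_one_sub_mul_pow (q z : K) (s : ℕ) : ∏ t ∈ Finset.range s, (1 - z * q ^ (t + 1)) =
    ∑ j ∈ Finset.range (s + 1), (-1) ^ j * z ^ j * q ^ (j * (j + 1) / 2) * gaussBinom q s j := by
  induction s generalizing z with
  | zero => simp [gaussBinom]
  | succ s ih =>
    have h1 : ∏ t ∈ Finset.range s, (1 - z * q ^ (t + 1 + 1)) =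
        ∏ t ∈ Finset.range s, (1 - z * q * q ^ (t + 1)) :=
      Finset.prod_congr rfl fun t _ => by ring
    have h2 : ∀ j, q ^ ((j + 1) * (j + 1 + 1) / 2) = q ^ (j * (j + 1) / 2) * q ^ (j + 1) := by
      intro j
      rw [← pow_add]
      congr 1
      rw [show (j + 1) * (j + 1 + 1) = j * (j + 1) + (j + 1) * 2 by ring,
        Nat.add_mul_div_right _ _ (by norm_num)]
    rw [Finset.prod_range_succ', h1, ih, Finset.sum_range_succ' _ (s + 1)]
    have h3 : ∑ j ∈ Finset.range (s + 1), (-1) ^ (j + 1) * z ^ (j + 1) *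
        q ^ ((j + 1) * (j + 1 + 1) / 2) * gaussBinom q (s + 1) (j + 1) =
        ∑ j ∈ Finset.range (s + 1), (-1) ^ (j + 1) * (z * q) ^ (j + 1) *
          q ^ ((j + 1) * (j + 1 + 1) / 2) * gaussBinom q s (j + 1) +
        ∑ j ∈ Finset.range (s + 1), (-1) ^ j * (z * q) ^ j * q ^ (j * (j + 1) / 2) *
          gaussBinom q s j * (-(z * q)) := by
      rw [← Finset.sum_add_distrib]
      refine Finset.sum_congr rfl fun j _ => ?_
      rw [gaussBinom, h2]
      ring
    have h4 := Finset.sum_range_succ' (fun j => (-1) ^ j * (z * q) ^ j * q ^ (j * (j + 1) / 2) *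
      gaussBinom q s j) (s + 1)
    rw [Finset.sum_range_succ, gaussBinom_eq_zero q (by omega : s < s + 1)] at h4
    rw [h3, ← Finset.sum_mul]
    have h5 : gaussBinom q (s + 1) 0 = 1 := by rw [gaussBinom]
    have h6 : gaussBinom q s 0 = 1 := by rw [gaussBinom]
    simp only [h6] at h4
    rw [h5]
    linear_combination h4

end ClosedForm

/-! ### Summation over all colourings with a given first block -/

theorem count_add_count_add_count {n : ℕ} (c : Fin n → Place) :
    count c .fst + count c .neg + count c .pos = n := by
  rw [← Place.sum_univ]
  simp only [count]
  rw [Finset.sum_comm]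
  simp

theorem sum_range_two_mul_add_one {M : Type*} [AddCommMonoid M] (f : ℕ → M) (s : ℕ) :
    ∑ j ∈ Finset.range (2 * s + 1), f j =
      ∑ j ∈ Finset.range (s + 1), f (2 * j) + ∑ j ∈ Finset.range s, f (2 * j + 1) := by
  induction s with
  | zero => simp
  | succ s ih =>
    rw [show 2 * (s + 1) + 1 = 2 * s + 1 + 1 + 1 by ring, Finset.sum_range_succ,
      Finset.sum_range_succ, ih, Finset.sum_range_succ (fun j => f (2 * j)) (s + 1),
      Finset.sum_range_succ (fun j => f (2 * j + 1)) s]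
    rw [show 2 * (s + 1) = 2 * s + 1 + 1 by ring]
    abel

section Total

variable {K : Type*} [Field K] (x : K)

theorem sum_colouring_eq_sum_colGen (a b : ℕ) :
    (∑ c : Fin (a + b) → Place, if count c .fst = a then (-1) ^ colLen c * x ^ colOddLen c else 0) =
      ∑ j ∈ Finset.range (b + 1), colGen x (a + b) a j (b - j) := by
  simp only [colGen]
  rw [Finset.sum_comm]
  refine Finset.sum_congr rfl fun c _ => ?_
  have hc := count_add_count_add_count c
  split_ifs with h
  · rw [Finset.sum_eq_single (count c .neg)]
    · rw [if_pos ⟨h, rfl, by omega⟩]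
    · intro j _ hj
      rw [if_neg fun h' => hj h'.2.1.symm]
    · intro h'
      rw [Finset.mem_range] at h'
      omega
  · exact (Finset.sum_eq_zero fun j _ => if_neg fun h' => h h'.1).symm

variable {x}

/-- An odd number of negative values makes all three counts odd and contributes 0. For 2j of them
the q-multinomial factors as a q-binomial of r + s times one of s, and the sum over j is the
q-binomial theorem at q = x², z = q^r. -/
theorem sum_colouring_eq (hq : ∀ t, (x ^ 2) ^ (t + 1) ≠ 1) (r s : ℕ) :
    (∑ c : Fin (2 * r + 1 + 2 * s) → Place,
      if count c .fst = 2 * r + 1 then (-1) ^ colLen c * x ^ colOddLen c else 0) =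
    qProd (x ^ 2) (r + s) / (qProd (x ^ 2) r * qProd (x ^ 2) s) *
      ∏ t ∈ Finset.range s, (1 - (x ^ 2) ^ (r + t + 1)) := by
  have hcf := oddClosedForm hq (r + s)
  have hprod : ∏ t ∈ Finset.range s, (1 - (x ^ 2) ^ (r + t + 1)) =
      ∏ t ∈ Finset.range s, (1 - (x ^ 2) ^ r * (x ^ 2) ^ (t + 1)) :=
    Finset.prod_congr rfl fun t _ => by rw [add_assoc, pow_add _ r]
  rw [sum_colouring_eq_sum_colGen, sum_range_two_mul_add_one,
    show 2 * r + 1 + 2 * s = 2 * (r + s) + 1 by ring]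
  have hodd : ∑ j ∈ Finset.range s,
      colGen x (2 * (r + s) + 1) (2 * r + 1) (2 * j + 1) (2 * s - (2 * j + 1)) = 0 := by
    refine Finset.sum_eq_zero fun j hj => ?_
    rw [Finset.mem_range] at hj
    rw [show 2 * s - (2 * j + 1) = 2 * (s - j - 1) + 1 by omega]
    exact hcf.odd_odd_odd _ _ _ (by omega)
  rw [hodd, add_zero, hprod, prod_one_sub_mul_pow, Finset.mul_sum]
  refine Finset.sum_congr rfl fun j hj => ?_
  obtain ⟨l, rfl⟩ := Nat.exists_eq_add_of_le (Nat.lt_succ_iff.1 (Finset.mem_range.1 hj))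
  have h1 := hcf.odd_even_even r j l (by omega)
  have h2 := gaussBinom_mul_qProd (x ^ 2) j l
  have hr := qProd_ne_zero hq r
  have hj := qProd_ne_zero hq j
  have hl := qProd_ne_zero hq l
  have hs := qProd_ne_zero hq (j + l)
  have h3 : x ^ (j * (2 * r + 1 + j)) = ((x ^ 2) ^ r) ^ j * (x ^ 2) ^ (j * (j + 1) / 2) := by
    have h4 : j * (j + 1) / 2 * 2 = j * (j + 1) :=
      Nat.div_mul_cancel (Nat.even_mul_succ_self j).two_dvd
    rw [← pow_mul, ← pow_mul, ← pow_mul, ← pow_add]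
    congr 1
    rw [mul_comm 2 (_ / 2), h4]
    ring
  rw [show 2 * (j + l) - 2 * j = 2 * l by omega]
  refine mul_right_cancel₀ (mul_ne_zero (mul_ne_zero hr hj) hl) (h1.trans ?_)
  rw [div_mul_eq_mul_div, div_mul_eq_mul_div, eq_div_iff (mul_ne_zero hr hs), h3, ← h2]
  ring

end Total

/-! ### The parabolic quotient in one-line notation -/

/-- The shape of the one-line notation of the elements of the parabolic quotient. -/
structure IsTwoBlock (a n : ℕ) (w : Equiv.Perm ℤ) : Prop where
  signed : w ∈ signedPerms n
  fst : ∀ i j : ℤ, 1 ≤ i → i < j → j ≤ a → |w i| < w j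
  snd : ∀ i j : ℤ, a < i → i < j → j ≤ n → w i < w j

theorem lt_of_forall_lt_add_one {f : ℤ → ℤ} {a b : ℤ} (h : ∀ i, a ≤ i → i < b → f i < f (i + 1))
    {i j : ℤ} (hi : a ≤ i) (hij : i < j) (hj : j ≤ b) : f i < f j := by
  induction j, hij using Int.leInduction with
  | base => exact h i hi (by omega)
  | succ k hk ih => exact (ih (by omega)).trans (h k (by omega) (by omega))

/-- The generators s_i with i ≥ 1 give increasing runs on the two blocks. The generator s_0 adds
-w(2) < w(1), which turns the first run into |w(i)| < w(j). -/
theorem mem_quotient_iff {a n : ℕ} (ha : 2 ≤ a) (han : a + 2 ≤ n) {w : Equiv.Perm ℤ} :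
    w ∈ quotient n (Set.Icc 0 (a - 1) ∪ Set.Icc (a + 1) (n - 1)) ↔
      w ∈ evenSignedPerms n ∧ IsTwoBlock a n w := by
  constructor
  · rintro ⟨hw, h⟩
    have hs := hw.1
    have h0 := (len_lt_len_mul_simpleReflection_zero_iff (by omega) hs).1
      (h 0 (Or.inl ⟨le_rfl, by omega⟩))
    have hsucc : ∀ i : ℤ, 1 ≤ i → i < n → i ≠ a → w i < w (i + 1) := by
      intro i h1 h2 h3
      obtain ⟨k, rfl⟩ : ∃ k : ℕ, i = k + 1 := ⟨(i - 1).toNat, by omega⟩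
      refine (len_lt_len_mul_simpleReflection_succ_iff hs (by omega)).1 (h (k + 1) ?_)
      rcases lt_or_ge (k + 1) a with h4 | h4
      · exact Or.inl ⟨by omega, by omega⟩
      · exact Or.inr ⟨by omega, by omega⟩
    refine ⟨hw, hs, fun i j hi hij hj => ?_, fun i j hi hij hj => ?_⟩
    · have mono : ∀ {i j : ℤ}, 1 ≤ i → i < j → j ≤ a → w i < w j := fun h1 h2 h3 =>
        lt_of_forall_lt_add_one (fun i h1 h2 => hsucc i h1 (by omega) (by omega)) h1 h2 h3
      have h12 := mono (i := 1) (j := 2) (by omega) (by omega) (by omega)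
      have hlt := mono hi hij hj
      refine abs_lt.2 ⟨?_, hlt⟩
      rcases eq_or_lt_of_le hi with rfl | hi'
      · rcases eq_or_lt_of_le (show 2 ≤ j by omega) with rfl | h2
        · omega
        · have := mono (i := 2) (by omega) h2 hj
          omega
      · rcases eq_or_lt_of_le (show 2 ≤ i by omega) with rfl | h2
        · omega
        · have := mono (i := 2) (by omega) h2 (by omega)
          omega
    · exact lt_of_forall_lt_add_one (a := a + 1) (b := n)
        (fun i h1 h2 => hsucc i (by omega) h2 (by omega)) hi hij hj
  · rintro ⟨hw, hs, h1, h2⟩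
    refine ⟨hw, fun i hi => ?_⟩
    rcases i with _ | i
    · rw [len_lt_len_mul_simpleReflection_zero_iff (by omega) hs]
      have := h1 1 2 (by omega) (by omega) (by omega)
      rw [abs_lt] at this
      omega
    · have hi' : i + 2 ≤ n ∧ (i + 2 ≤ a ∨ a + 1 ≤ i + 1) := by
        rcases hi with ⟨-, h⟩ | ⟨h, h'⟩ <;> omega
      rw [len_lt_len_mul_simpleReflection_succ_iff hs hi'.1]
      rcases hi'.2 with h | h
      · exact (le_abs_self _).trans_lt (h1 _ _ (by omega) (by omega) (by omega))
      · exact h2 _ _ (by omega) (by omega) (by omega)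

/-! ### From signed permutations to colourings -/

/-- The places of the values of `w`. -/
def colouring (a n : ℕ) (w : Equiv.Perm ℤ) (v : Fin n) : Place :=
  if |w⁻¹ ((v : ℤ) + 1)| ≤ a then .fst else if w⁻¹ ((v : ℤ) + 1) < 0 then .neg else .pos

/-- The position in the one-line notation of the value of rank `t` in place `p`. -/
def position (a n : ℕ) : Place → ℕ → ℤ
  | .fst, t => a - t
  | .neg, t => a + 1 + t
  | .pos, t => n - t

theorem inv_value_cases {n : ℕ} {w : Equiv.Perm ℤ} (hw : w ∈ signedPerms n) (v : Fin n) :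
    ∃ p : ℤ, 1 ≤ p ∧ p ≤ n ∧ |w⁻¹ ((v : ℤ) + 1)| = p ∧
      ((w⁻¹ ((v : ℤ) + 1) = p ∧ w p = v + 1) ∨ (w⁻¹ ((v : ℤ) + 1) = -p ∧ w p = -(v + 1))) := by
  have hg := inv_mem_signedPerms hw
  have hv : |(v : ℤ) + 1| = v + 1 := abs_of_pos (by omega)
  refine ⟨_, one_le_abs_apply hg (x := (v : ℤ) + 1) (by omega), abs_apply_le hg (by omega), rfl, ?_⟩
  rcases abs_choice (w⁻¹ ((v : ℤ) + 1)) with h | h <;> rw [h]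
  · left; simp
  · right; simp [hw.1]

/-- The map v ↦ |g(v)| permutes {1, …, n}, so each position in S holds exactly one value. -/
theorem card_filter_abs_inv {n : ℕ} {g : Equiv.Perm ℤ} (hg : g ∈ signedPerms n) {S : Finset ℤ}
    (hS : S ⊆ Finset.Icc 1 (n : ℤ)) :
    (Finset.univ.filter fun u : Fin n => |g ((u : ℤ) + 1)| ∈ S).card = S.card := by
  refine Finset.card_bij (fun u _ => |g ((u : ℤ) + 1)|) (fun u hu => (Finset.mem_filter.1 hu).2)
    (fun u _ v _ h => ?_) fun p hp => ?_
  · rw [abs_apply_eq_iff hg, abs_of_pos (by omega), abs_of_pos (by omega)] at h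
    exact Fin.ext (by omega)
  · have hp' := Finset.mem_Icc.1 (hS hp)
    have hp1 : |p| = p := abs_of_pos (by omega)
    have hg' := inv_mem_signedPerms hg
    have h1 := one_le_abs_apply hg' (x := p) (by omega)
    have h2 := abs_apply_le hg' (i := p) (by omega)
    have h3 : |g ((((|g⁻¹ p| - 1).toNat : ℕ) : ℤ) + 1)| = p := by
      rw [show (((|g⁻¹ p| - 1).toNat : ℕ) : ℤ) + 1 = |g⁻¹ p| by omega]
      rcases abs_choice (g⁻¹ p) with h | h <;> rw [h]
      · simp [hp1]
      · simp [hg.1, hp1]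
    exact ⟨⟨(|g⁻¹ p| - 1).toNat, by omega⟩, Finset.mem_filter.2 ⟨Finset.mem_univ _, h3.symm ▸ hp⟩, h3⟩

theorem rank_eq_card {n : ℕ} (c : Fin n → Place) (v : Fin n) :
    rank c v = (Finset.univ.filter fun u => v < u ∧ c u = c v).card := by
  rw [rank, Finset.card_filter]

theorem count_eq_card {n : ℕ} (c : Fin n → Place) (p : Place) :
    count c p = (Finset.univ.filter fun u => c u = p).card := by
  rw [count, Finset.card_filter]

theorem colouring_eq_iff {a n : ℕ} {w : Equiv.Perm ℤ} (v : Fin n) :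
    (colouring a n w v = .fst ↔ |w⁻¹ ((v : ℤ) + 1)| ≤ a) ∧
    (colouring a n w v = .neg ↔ a < |w⁻¹ ((v : ℤ) + 1)| ∧ w⁻¹ ((v : ℤ) + 1) < 0) ∧
    (colouring a n w v = .pos ↔ a < |w⁻¹ ((v : ℤ) + 1)| ∧ 0 ≤ w⁻¹ ((v : ℤ) + 1)) := by
  rw [colouring]
  split_ifs <;> simp only [true_iff, false_iff] <;> omega

theorem count_colouring {a n : ℕ} (han : a ≤ n) {w : Equiv.Perm ℤ} (hw : w ∈ signedPerms n) :
    count (colouring a n w) .fst = a := by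
  rw [count_eq_card]
  have h := card_filter_abs_inv (inv_mem_signedPerms hw) (S := Finset.Icc 1 (a : ℤ))
    (Finset.Icc_subset_Icc le_rfl (by omega))
  rw [Int.card_Icc, add_sub_cancel_right, Int.toNat_natCast] at h
  rw [← h]
  congr 1
  refine Finset.filter_congr fun u _ => ?_
  obtain ⟨p, hp⟩ := inv_value_cases hw u
  rw [(colouring_eq_iff u).1, Finset.mem_Icc]
  omega

namespace IsTwoBlock

variable {a n : ℕ} {w : Equiv.Perm ℤ}

theorem pos_of_two_le (h : IsTwoBlock a n w) {p : ℤ} (h2 : 2 ≤ p) (hp : p ≤ a) : 0 < w p :=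
  (abs_nonneg _).trans_lt (h.fst 1 p le_rfl (by omega) hp)

/-- Let p be the position of the value. The larger values of its colour fill exactly the positions
(p, a] in the first block, (a, p) among the negative entries, where larger absolute values come
first, and (p, n] among the positive ones. Counting gives the rank. -/
theorem abs_inv (han : a ≤ n) (h : IsTwoBlock a n w) (v : Fin n) :
    |w⁻¹ ((v : ℤ) + 1)| = position a n (colouring a n w v) (rank (colouring a n w) v) := by
  obtain ⟨p, hp1, hp2, hp3, hp4⟩ := inv_value_cases h.signed v
  have card := @card_filter_abs_inv n _ (inv_mem_signedPerms h.signed)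
  rw [rank_eq_card]
  have hcol := @colouring_eq_iff a n w v
  rw [hp3] at hcol ⊢
  cases hc : colouring a n w v with
  | fst =>
    have hpa := hcol.1.1 hc
    have h1 := card (S := Finset.Ioc p a) fun x hx => by
      rw [Finset.mem_Ioc] at hx
      rw [Finset.mem_Icc]
      omega
    rw [Int.card_Ioc] at h1
    have h2 : (Finset.univ.filter fun u => v < u ∧ colouring a n w u = .fst).card =
        ((a : ℤ) - p).toNat := by
      rw [← h1]
      congr 1
      refine Finset.filter_congr fun u _ => ?_
      obtain ⟨q, hq1, hq2, hq3, hq4⟩ := inv_value_cases h.signed u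
      rw [(colouring_eq_iff u).1, Finset.mem_Ioc, hq3, Fin.lt_def]
      have f1 := h.fst p q
      have f2 := h.fst q p
      -- For `omega`, w p and w q are unrelated atoms; this links them when p = q.
      have f3 : p = q → w p = w q := fun h => by rw [h]
      rw [abs_lt] at f1 f2
      omega
    rw [h2, position]
    omega
  | neg =>
    have hpa := hcol.2.1.1 hc
    have h1 := card (S := Finset.Ioo a p) fun x hx => by
      rw [Finset.mem_Ioo] at hx
      rw [Finset.mem_Icc]
      omega
    rw [Int.card_Ioo] at h1
    have h2 : (Finset.univ.filter fun u => v < u ∧ colouring a n w u = .neg).card =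
        (p - (a : ℤ) - 1).toNat := by
      rw [← h1]
      congr 1
      refine Finset.filter_congr fun u _ => ?_
      obtain ⟨q, hq1, hq2, hq3, hq4⟩ := inv_value_cases h.signed u
      rw [(colouring_eq_iff u).2.1, Finset.mem_Ioo, hq3, Fin.lt_def]
      have f1 := h.snd p q
      have f2 := h.snd q p
      have f3 : p = q → w p = w q := fun h => by rw [h]
      omega
    rw [h2, position]
    omega
  | pos =>
    have hpa := hcol.2.2.1 hc
    have h1 := card (S := Finset.Ioc p n) fun x hx => by
      rw [Finset.mem_Ioc] at hx
      rw [Finset.mem_Icc]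
      omega
    rw [Int.card_Ioc] at h1
    have h2 : (Finset.univ.filter fun u => v < u ∧ colouring a n w u = .pos).card =
        ((n : ℤ) - p).toNat := by
      rw [← h1]
      congr 1
      refine Finset.filter_congr fun u _ => ?_
      obtain ⟨q, hq1, hq2, hq3, hq4⟩ := inv_value_cases h.signed u
      rw [(colouring_eq_iff u).2.2, Finset.mem_Ioc, hq3, Fin.lt_def]
      have f1 := h.snd p q
      have f2 := h.snd q p
      have f3 : p = q → w p = w q := fun h => by rw [h]
      omega
    rw [h2, position]
    omega

/-- Across blocks, the second-block position has the larger absolute value and decides the signs of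
sum and difference. Inside the first block the larger value sits at a position at least 2, where
entries are positive, so the unknown sign of w(1) does not matter. -/
theorem pairWeight_eq (h : IsTwoBlock a n w) {u v : Fin n} (huv : v < u) :
    pairWeight (fun _ => True) (w⁻¹ ((u : ℤ) + 1)) (w⁻¹ ((v : ℤ) + 1)) =
      placeWeight (colouring a n w u) (colouring a n w v) := by
  obtain ⟨p, hp1, hp2, hp3, hp4⟩ := inv_value_cases h.signed v
  obtain ⟨q, hq1, hq2, hq3, hq4⟩ := inv_value_cases h.signed u
  rw [Fin.lt_def] at huv
  have f1 := h.fst p q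
  have f2 := h.snd q p
  have f3 := h.fst q p
  have f4 := h.snd p q
  have f5 : p = q → w p = w q := fun h => by rw [h]
  rw [abs_lt] at f1 f3
  have cu := @colouring_eq_iff a n w u
  have cv := @colouring_eq_iff a n w v
  rw [hq3] at cu
  rw [hp3] at cv
  have f6 := h.pos_of_two_le (p := q)
  simp only [pairWeight, and_true]
  cases hcu : colouring a n w u <;> cases hcv : colouring a n w v <;>
    simp only [hcu, hcv, true_iff, reduceCtorEq, false_iff] at cu cv <;>
    simp only [placeWeight] <;> split_ifs <;> omega

theorem len_eq (hn : 2 ≤ n) (h : IsTwoBlock a n w) : len n w = colLen (colouring a n w) := by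
  rw [len_eq_ncard_invSet hn h.signed, ncard_invSet h.signed (by simp), colLen]
  refine Finset.sum_congr rfl fun v _ => Finset.sum_congr rfl fun u _ => ?_
  split_ifs with huv
  · exact h.pairWeight_eq huv
  · rfl

/-- Here a and n must be odd: a - t ≡ t + 1, a + 1 + t ≡ t and n - t ≡ t + 1 modulo 2, and passing
from ±p to p keeps parity. -/
theorem odd_inv_add_inv_iff (han : a ≤ n) (ha : Odd a) (hn : Odd n) (h : IsTwoBlock a n w)
    (u v : Fin n) : Odd (w⁻¹ ((u : ℤ) + 1) + w⁻¹ ((v : ℤ) + 1)) ↔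
      Odd (parity (colouring a n w u) (rank (colouring a n w) u) +
        parity (colouring a n w v) (rank (colouring a n w) v)) := by
  have key : ∀ v : Fin n, w⁻¹ ((v : ℤ) + 1) % 2 =
      (parity (colouring a n w v) (rank (colouring a n w) v) : ℤ) % 2 := by
    intro v
    have h1 := h.abs_inv han v
    rw [Nat.odd_iff] at ha hn
    have h2 : |w⁻¹ ((v : ℤ) + 1)| % 2 = w⁻¹ ((v : ℤ) + 1) % 2 := by
      rcases abs_choice (w⁻¹ ((v : ℤ) + 1)) with h | h <;> rw [h]
      omega
    rw [← h2, h1]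
    cases colouring a n w v <;> simp only [position, parity] <;> omega
  rw [Int.odd_iff, Nat.odd_iff]
  have := key u
  have := key v
  omega

theorem oddLen_eq (hn : 2 ≤ n) (han : a ≤ n) (ha : Odd a) (hn' : Odd n) (h : IsTwoBlock a n w) :
    oddLen n w = colOddLen (colouring a n w) := by
  rw [oddLen_eq_ncard_invSet hn h.signed, ncard_invSet h.signed (by simp), colOddLen]
  refine Finset.sum_congr rfl fun v _ => Finset.sum_congr rfl fun u _ => ?_
  split_ifs with huv hodd
  · rw [← h.odd_inv_add_inv_iff han ha hn'] at hodd
    rw [← h.pairWeight_eq huv]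
    -- Sum and difference of two integers have the same parity, so the odd condition keeps or drops
    -- both terms together.
    simp only [pairWeight, hodd, Int.odd_sub.trans Int.odd_add.symm, and_true]
  · rw [← h.odd_inv_add_inv_iff han ha hn'] at hodd
    simp only [pairWeight, hodd, Int.odd_sub.trans Int.odd_add.symm, and_false, if_false]
  · rfl

end IsTwoBlock

theorem card_filter_apply_neg {n : ℕ} (hn : 1 ≤ n) (w : Equiv.Perm ℤ) :
    ((Finset.Icc (1 : ℤ) n).filter fun i => w i < 0).card =
      (if w 1 < 0 then 1 else 0) + ((Finset.Icc (2 : ℤ) n).filter fun i => w i < 0).card := by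
  rw [Finset.card_filter, Finset.card_filter, ← Finset.sum_erase_add _ _
    (Finset.mem_Icc.2 ⟨le_rfl, by omega⟩ : (1 : ℤ) ∈ Finset.Icc (1 : ℤ) n), add_comm]
  congr 2
  ext i
  simp only [Finset.mem_erase, Finset.mem_Icc]
  omega

/-- Both permutations have an even number of negative entries and agree beyond position 1, so the
sign of the first entry is forced. -/
theorem eq_of_eq_off_one {n : ℕ} (hn : 1 ≤ n) {w w' : Equiv.Perm ℤ} (hw : w ∈ evenSignedPerms n)
    (hw' : w' ∈ evenSignedPerms n) (h1 : |w 1| = |w' 1|)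
    (h2 : ∀ p : ℤ, 2 ≤ p → p ≤ n → w p = w' p) : w = w' := by
  have hcongr : ((Finset.Icc (2 : ℤ) n).filter fun i => w i < 0).card =
      ((Finset.Icc (2 : ℤ) n).filter fun i => w' i < 0).card := by
    congr 1
    refine Finset.filter_congr fun i hi => ?_
    rw [Finset.mem_Icc] at hi
    rw [h2 i hi.1 hi.2]
  have e1 := hw.2
  have e2 := hw'.2
  rw [card_filter_apply_neg hn, Nat.even_iff] at e1 e2
  rw [hcongr] at e1
  have hne : w 1 ≠ 0 := fun h => by simpa [h] using one_le_abs_apply hw.1 (x := 1) (by simp)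
  have h11 : w 1 = w' 1 := by
    rcases abs_eq_abs.1 h1 with h | h
    · exact h
    · split_ifs at e1 e2 <;> omega
  have hpos : ∀ p : ℤ, 1 ≤ p → w p = w' p := by
    intro p hp
    rcases lt_or_ge (n : ℤ) p with h | h
    · rw [hw.1.2 p (by rwa [abs_of_pos (by omega)]), hw'.1.2 p (by rwa [abs_of_pos (by omega)])]
    · rcases eq_or_lt_of_le hp with rfl | hp'
      · exact h11
      · exact h2 p (by omega) h
  ext p
  rcases lt_trichotomy p 0 with h | rfl | h
  · have := hpos (-p) (by omega)
    rwa [hw.1.1, hw'.1.1, neg_inj] at this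
  · rw [apply_zero hw.1, apply_zero hw'.1]
  · exact hpos p (by omega)

/-- Ranks recover absolute positions, colours recover signs in the second block, and first-block
entries from position 2 on are positive. Only the sign of w(1) is left, which evenness settles. -/
theorem colouring_injective {a n : ℕ} (han : a ≤ n) (hn : 1 ≤ n) {w w' : Equiv.Perm ℤ}
    (hw : w ∈ evenSignedPerms n) (hw' : w' ∈ evenSignedPerms n) (h : IsTwoBlock a n w)
    (h' : IsTwoBlock a n w') (hc : colouring a n w = colouring a n w') : w = w' := by
  have key : ∀ v : Fin n, |w⁻¹ ((v : ℤ) + 1)| = |w'⁻¹ ((v : ℤ) + 1)| ∧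
      (2 ≤ |w⁻¹ ((v : ℤ) + 1)| → w⁻¹ ((v : ℤ) + 1) = w'⁻¹ ((v : ℤ) + 1)) := by
    intro v
    have h1 := h.abs_inv han v
    rw [hc, ← h'.abs_inv han] at h1
    refine ⟨h1, fun h2 => ?_⟩
    obtain ⟨p, hp1, hp2, hp3, hp4⟩ := inv_value_cases h.signed v
    obtain ⟨q, hq1, hq2, hq3, hq4⟩ := inv_value_cases h'.signed v
    obtain rfl : p = q := by omega
    have c1 := @colouring_eq_iff a n w v
    have c2 := @colouring_eq_iff a n w' v
    rw [hc] at c1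
    have f1 := h.pos_of_two_le (p := p)
    have f2 := h'.pos_of_two_le (p := p)
    rw [hp3] at c1
    rw [hq3] at c2
    cases hcv : colouring a n w' v <;>
      simp only [hcv, true_iff, reduceCtorEq, false_iff] at c1 c2 <;> omega
  have hval : ∀ p : ℤ, 1 ≤ p → p ≤ n → ∃ v : Fin n, |w⁻¹ ((v : ℤ) + 1)| = p := by
    intro p h1 h2
    have hp : |p| = p := abs_of_pos (by omega)
    have h3 := one_le_abs_apply h.signed (x := p) (by omega)
    have h4 := abs_apply_le h.signed (i := p) (by omega)
    refine ⟨⟨(|w p| - 1).toNat, by omega⟩, ?_⟩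
    change |w⁻¹ ((((|w p| - 1).toNat : ℕ) : ℤ) + 1)| = p
    rw [show (((|w p| - 1).toNat : ℕ) : ℤ) + 1 = |w p| by omega]
    rcases abs_choice (w p) with h5 | h5 <;> rw [h5]
    · simp [hp]
    · simp [(inv_mem_signedPerms h.signed).1, hp]
  refine eq_of_eq_off_one hn hw hw' ?_ fun p h1 h2 => ?_
  · obtain ⟨v, hv⟩ := hval 1 le_rfl (by omega)
    obtain ⟨p, hp1, hp2, hp3, hp4⟩ := inv_value_cases h.signed v
    obtain ⟨q, hq1, hq2, hq3, hq4⟩ := inv_value_cases h'.signed v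
    have := key v
    obtain rfl : p = 1 := by omega
    obtain rfl : q = 1 := by omega
    have e1 : |w 1| = v + 1 := by
      rcases hp4 with ⟨-, h⟩ | ⟨-, h⟩ <;> rw [h, abs_eq (by omega)] <;> simp
    have e2 : |w' 1| = v + 1 := by
      rcases hq4 with ⟨-, h⟩ | ⟨-, h⟩ <;> rw [h, abs_eq (by omega)] <;> simp
    rw [e1, e2]
  · obtain ⟨v, hv⟩ := hval p (by omega) h2
    obtain ⟨q, hq1, hq2, hq3, hq4⟩ := inv_value_cases h.signed v
    obtain ⟨r, hr1, hr2, hr3, hr4⟩ := inv_value_cases h'.signed v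
    have := key v
    obtain rfl : q = p := by omega
    obtain rfl : r = q := by omega
    omega

/-! ### From colourings back to signed permutations -/

/-- Extend f oddly, and by the identity outside [-n, n]. -/
theorem exists_signedPerm {n : ℕ} (f : Fin n → ℤ) (h1 : ∀ v, 1 ≤ |f v|) (h2 : ∀ v, |f v| ≤ n)
    (hinj : ∀ u v, |f u| = |f v| → u = v) :
    ∃ σ ∈ signedPerms n, ∀ v : Fin n, σ ((v : ℤ) + 1) = f v := by
  classical
  let F₀ : ℤ → ℤ := fun k => if h : 1 ≤ k ∧ k ≤ n then f ⟨(k - 1).toNat, by omega⟩ else k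
  let F : ℤ → ℤ := fun k => if 0 ≤ k then F₀ k else -F₀ (-k)
  have hF₀ : ∀ v : Fin n, F₀ ((v : ℤ) + 1) = f v := by
    intro v
    have hv := v.2
    simp only [F₀]
    rw [dif_pos ⟨by omega, by omega⟩]
    congr 1
    ext
    simp
  have hF₀0 : F₀ 0 = 0 := by simp [F₀]
  have hodd : ∀ k, F (-k) = -F k := by
    intro k
    simp only [F]
    rcases lt_trichotomy k 0 with h | rfl | h
    · rw [if_pos (by omega), if_neg (by omega), neg_neg]
    · simp [hF₀0]
    · rw [if_neg (by omega), if_pos (by omega), neg_neg]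
  have hF : ∀ v : Fin n, F ((v : ℤ) + 1) = f v := by
    intro v
    simp only [F]
    rw [if_pos (by omega), hF₀]
  have hbig : ∀ k : ℤ, (n : ℤ) < |k| → F k = k := by
    intro k hk
    simp only [F]
    split_ifs with h
    · rw [abs_of_nonneg h] at hk
      simp only [F₀]
      rw [dif_neg (by omega)]
    · rw [abs_of_neg (by omega)] at hk
      simp only [F₀]
      rw [dif_neg (by omega), neg_neg]
  have hF0 : F 0 = 0 := by simp [F, hF₀0]
  have cases_k : ∀ k : ℤ, (n : ℤ) < |k| ∨ k = 0 ∨ ∃ v : Fin n, k = v + 1 ∨ k = -((v : ℤ) + 1) := by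
    intro k
    rcases lt_or_ge (n : ℤ) |k| with h | h
    · exact Or.inl h
    · right
      rcases eq_or_ne k 0 with h0 | h0
      · exact Or.inl h0
      · have := Int.one_le_abs h0
        refine Or.inr ⟨⟨(|k| - 1).toNat, by omega⟩, ?_⟩
        change k = (((|k| - 1).toNat : ℕ) : ℤ) + 1 ∨ k = -((((|k| - 1).toNat : ℕ) : ℤ) + 1)
        rw [show (((|k| - 1).toNat : ℕ) : ℤ) + 1 = |k| by omega]
        exact eq_or_eq_neg_of_abs_eq rfl
  have hsurj : Function.Surjective F := by
    intro y
    rcases cases_k y with h | rfl | ⟨v, hv⟩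
    · exact ⟨y, hbig y h⟩
    · exact ⟨0, hF0⟩
    -- Injectivity of |f| on a finite set makes it a permutation of {1, …, n}, hence surjective.
    · let φ : Fin n → Fin n := fun v => ⟨(|f v| - 1).toNat, by have := h1 v; have := h2 v; omega⟩
      have hφ : Function.Injective φ := by
        intro u v huv
        have := congrArg Fin.val huv
        simp only [φ] at this
        have := h1 u
        have := h1 v
        exact hinj u v (by omega)
      obtain ⟨u, hu⟩ := Finite.injective_iff_surjective.1 hφ v
      have hu' := congrArg Fin.val hu
      simp only [φ] at hu'
      have := h1 u
      have habs : |f u| = v + 1 := by omega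
      have : y = f u ∨ y = -f u := by
        rcases abs_choice (f u) with h | h <;> omega
      rcases this with rfl | rfl
      · exact ⟨u + 1, hF u⟩
      · exact ⟨-(u + 1), by rw [hodd, hF]⟩
  have habs : ∀ v : Fin n, |F ((v : ℤ) + 1)| = |f v| := fun v => by rw [hF]
  have hinjF : Function.Injective F := by
    have absF : ∀ k, (k = 0 ∧ F k = 0) ∨ ((n : ℤ) < |k| ∧ F k = k) ∨
        ∃ v : Fin n, (k = v + 1 ∧ F k = f v) ∨ (k = -((v : ℤ) + 1) ∧ F k = -f v) := by
      intro k
      rcases cases_k k with h | rfl | ⟨v, rfl | rfl⟩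
      · exact Or.inr (Or.inl ⟨h, hbig k h⟩)
      · exact Or.inl ⟨rfl, hF0⟩
      · exact Or.inr (Or.inr ⟨v, Or.inl ⟨rfl, hF v⟩⟩)
      · exact Or.inr (Or.inr ⟨v, Or.inr ⟨rfl, by rw [hodd, hF]⟩⟩)
    have bound : ∀ v : Fin n, f v ≠ 0 ∧ -(n : ℤ) ≤ f v ∧ f v ≤ n := fun v =>
      ⟨fun h => by simpa [h] using h1 v, abs_le.1 (h2 v)⟩
    intro k l hkl
    rcases absF k with ⟨hk, hk'⟩ | ⟨hk, hk'⟩ | ⟨u, hk⟩ <;>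
      rcases absF l with ⟨hl, hl'⟩ | ⟨hl, hl'⟩ | ⟨v, hl⟩
    · omega
    · omega
    · have := bound v
      omega
    · omega
    · omega
    · have := bound v
      rw [lt_abs] at hk
      omega
    · have := bound u
      omega
    · have := bound u
      rw [lt_abs] at hl
      omega
    · have := bound u
      have huv : u = v := by
        refine hinj u v (abs_eq_abs.2 ?_)
        omega
      subst huv
      omega
  exact ⟨Equiv.ofBijective F ⟨hinjF, hsurj⟩, ⟨hodd, hbig⟩, hF⟩

theorem rank_lt_rank {n : ℕ} {c : Fin n → Place} {u v : Fin n} (huv : v < u) (hc : c u = c v) :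
    rank c u < rank c v := by
  rw [rank_eq_card, rank_eq_card]
  refine Finset.card_lt_card (Finset.ssubset_iff_of_subset (fun x hx => ?_) |>.2 ⟨u, ?_, ?_⟩)
  · rw [Finset.mem_filter] at hx ⊢
    exact ⟨hx.1, huv.trans hx.2.1, hx.2.2.trans hc⟩
  · simp [huv, hc]
  · simp

theorem rank_lt_count {n : ℕ} (c : Fin n → Place) (v : Fin n) : rank c v < count c (c v) := by
  rw [rank_eq_card, count_eq_card]
  refine Finset.card_lt_card (Finset.ssubset_iff_of_subset (fun x hx => ?_) |>.2 ⟨v, ?_, ?_⟩)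
  · rw [Finset.mem_filter] at hx ⊢
    exact ⟨hx.1, hx.2.2⟩
  · simp
  · simp

theorem swap_neg_mem_signedPerms {n : ℕ} (hn : 1 ≤ n) : Equiv.swap 1 (-1) ∈ signedPerms n := by
  refine ⟨fun i => ?_, fun i hi => ?_⟩
  · simp only [Equiv.swap_apply_def]
    split_ifs <;> omega
  · rw [lt_abs] at hi
    rw [Equiv.swap_apply_of_ne_of_ne] <;> omega

/-- Multiplying by this swap flips the sign of w(1) alone. It keeps the block shape and the
colouring but changes the parity of the number of negative entries, so it corrects a non-even
preimage of a colouring. -/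
theorem IsTwoBlock.mul_swap {a n : ℕ} (ha : 1 ≤ a) (han : a ≤ n) {w : Equiv.Perm ℤ}
    (h : IsTwoBlock a n w) : IsTwoBlock a n (w * Equiv.swap 1 (-1)) where
  signed := mul_mem_signedPerms h.signed (swap_neg_mem_signedPerms (by omega))
  fst i j hi hij hj := by
    rw [Equiv.Perm.mul_apply, Equiv.Perm.mul_apply,
      Equiv.swap_apply_of_ne_of_ne (x := j) (by omega) (by omega)]
    rcases eq_or_lt_of_le hi with rfl | hi'
    · rw [Equiv.swap_apply_left, h.signed.1, abs_neg]
      exact h.fst _ _ le_rfl hij hj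
    · rw [Equiv.swap_apply_of_ne_of_ne (by omega) (by omega)]
      exact h.fst _ _ hi hij hj
  snd i j hi hij hj := by
    rw [Equiv.Perm.mul_apply, Equiv.Perm.mul_apply,
      Equiv.swap_apply_of_ne_of_ne (x := j) (by omega) (by omega),
      Equiv.swap_apply_of_ne_of_ne (by omega) (by omega)]
    exact h.snd _ _ hi hij hj

theorem colouring_mul_swap {a n : ℕ} (ha : 1 ≤ a) (w : Equiv.Perm ℤ) :
    colouring a n (w * Equiv.swap 1 (-1)) = colouring a n w := by
  funext v
  simp only [colouring, mul_inv_rev, Equiv.swap_inv, Equiv.Perm.mul_apply]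
  generalize w⁻¹ ((v : ℤ) + 1) = k
  rcases eq_or_ne k 1 with rfl | h1
  · simp [ha]
  · rcases eq_or_ne k (-1) with rfl | h2
    · simp [ha]
    · rw [Equiv.swap_apply_of_ne_of_ne h1 h2]

theorem even_or_mul_swap_even {n : ℕ} (hn : 1 ≤ n) {w : Equiv.Perm ℤ} (hw : w ∈ signedPerms n) :
    w ∈ evenSignedPerms n ∨ w * Equiv.swap 1 (-1) ∈ evenSignedPerms n := by
  by_cases h : Even ((Finset.Icc (1 : ℤ) n).filter fun i => w i < 0).card
  · exact Or.inl ⟨hw, h⟩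
  · refine Or.inr ⟨mul_mem_signedPerms hw (swap_neg_mem_signedPerms hn), ?_⟩
    have hne : w 1 ≠ 0 := fun h => by simpa [h] using one_le_abs_apply hw (x := 1) (by simp)
    have hcongr : ((Finset.Icc (2 : ℤ) n).filter fun i => (w * Equiv.swap 1 (-1) : Equiv.Perm ℤ) i < 0).card =
        ((Finset.Icc (2 : ℤ) n).filter fun i => w i < 0).card := by
      congr 1
      refine Finset.filter_congr fun i hi => ?_
      rw [Finset.mem_Icc] at hi
      rw [Equiv.Perm.mul_apply, Equiv.swap_apply_of_ne_of_ne (by omega) (by omega)]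
    rw [card_filter_apply_neg hn, Nat.even_iff] at h ⊢
    rw [hcongr, Equiv.Perm.mul_apply, Equiv.swap_apply_left, hw.1]
    split_ifs at h ⊢ <;> omega

theorem exists_colouring_eq {a n : ℕ} (ha : 1 ≤ a) (han : a ≤ n) (c : Fin n → Place)
    (hc : count c .fst = a) :
    ∃ w ∈ evenSignedPerms n, IsTwoBlock a n w ∧ colouring a n w = c := by
  suffices h : ∃ w, IsTwoBlock a n w ∧ colouring a n w = c by
    obtain ⟨w, h1, h2⟩ := h
    rcases even_or_mul_swap_even (by omega) h1.signed with h | h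
    · exact ⟨w, h, h1, h2⟩
    · exact ⟨_, h, h1.mul_swap ha han, (colouring_mul_swap ha w).trans h2⟩
  -- f is the intended inverse: it sends each value to its signed position. The permutation sought
  -- is therefore σ⁻¹, where σ extends f.
  let f : Fin n → ℤ := fun v =>
    if c v = .neg then -position a n (c v) (rank c v) else position a n (c v) (rank c v)
  have hsum := count_add_count_add_count c
  have hf : ∀ v, (c v = .fst ∧ f v = a - rank c v ∧ rank c v < a) ∨
      (c v = .neg ∧ f v = -(a + 1 + rank c v) ∧ rank c v < count c .neg) ∨
      (c v = .pos ∧ f v = n - rank c v ∧ rank c v < count c .pos) := by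
    intro v
    have := rank_lt_count c v
    cases h : c v <;> simp only [h] at this <;> simp only [f, h, position] <;> simp <;> omega
  have hrank : ∀ u v, c u = c v → (v < u ↔ rank c u < rank c v) := by
    intro u v h
    refine ⟨fun huv => rank_lt_rank huv h, fun hr => ?_⟩
    by_contra hle
    rcases eq_or_lt_of_le (not_lt.1 hle) with rfl | hlt
    · exact lt_irrefl _ hr
    · exact absurd (rank_lt_rank hlt h.symm) (by omega)
  have habs : ∀ v, |f v| = position a n (c v) (rank c v) := by
    intro v
    rcases hf v with ⟨h1, h2, h3⟩ | ⟨h1, h2, h3⟩ | ⟨h1, h2, h3⟩ <;> rw [h1, h2, position]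
    · exact abs_of_pos (by omega)
    · rw [abs_neg]
      exact abs_of_pos (by omega)
    · exact abs_of_pos (by omega)
  obtain ⟨σ, hσ, hσf⟩ := exists_signedPerm f
    (fun v => by
      rw [habs]
      rcases hf v with ⟨h1, h2, h3⟩ | ⟨h1, h2, h3⟩ | ⟨h1, h2, h3⟩ <;> rw [h1, position] <;> omega)
    (fun v => by
      rw [habs]
      rcases hf v with ⟨h1, h2, h3⟩ | ⟨h1, h2, h3⟩ | ⟨h1, h2, h3⟩ <;> rw [h1, position] <;> omega)
    (fun u v h => by
      rw [habs, habs] at h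
      -- The three colours occupy disjoint intervals of positions, because the counts add up to n
      -- and the first one is a.
      have hcuv : c u = c v := by
        rcases hf u with ⟨h1, h2, h3⟩ | ⟨h1, h2, h3⟩ | ⟨h1, h2, h3⟩ <;>
        rcases hf v with ⟨h4, h5, h6⟩ | ⟨h4, h5, h6⟩ | ⟨h4, h5, h6⟩ <;>
        rw [h1, h4] at h ⊢ <;> simp only [position] at h <;> omega
      have h1 := hrank u v hcuv
      have h2 := hrank v u hcuv.symm
      have h3 : rank c u = rank c v := by
        rw [hcuv] at h
        cases hcv : c v <;> simp only [hcv, position] at h <;> omega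
      rw [Fin.lt_def] at h1 h2
      exact Fin.ext (by omega))
  have hinv : σ⁻¹ ∈ signedPerms n := inv_mem_signedPerms hσ
  have hval : ∀ i : ℤ, 1 ≤ i → i ≤ n → ∃ v : Fin n,
      (f v = i ∧ σ⁻¹ i = v + 1) ∨ (f v = -i ∧ σ⁻¹ i = -(v + 1)) := by
    intro i h1 h2
    have hi : |i| = i := abs_of_pos (by omega)
    have h3 := one_le_abs_apply hinv (x := i) (by omega)
    have h4 := abs_apply_le hinv (i := i) (by omega)
    refine ⟨⟨(|σ⁻¹ i| - 1).toNat, by omega⟩, ?_⟩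
    rw [← hσf]
    have h5 : (((|σ⁻¹ i| - 1).toNat : ℕ) : ℤ) + 1 = |σ⁻¹ i| := by omega
    simp only [h5]
    rcases abs_choice (σ⁻¹ i) with h | h <;> rw [h]
    · left; simp
    · right; rw [hσ.1]; simp
  refine ⟨σ⁻¹, ⟨hinv, fun i j hi hij hj => ?_, fun i j hi hij hj => ?_⟩, ?_⟩
  · obtain ⟨u, hu⟩ := hval i hi (by omega)
    obtain ⟨v, hv⟩ := hval j (by omega) (by omega)
    have hfu := hf u
    have hfv := hf v
    have cu : c u = .fst := by rcases hfu with h | h | h <;> first | exact h.1 | omega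
    have cv : c v = .fst := by rcases hfv with h | h | h <;> first | exact h.1 | omega
    have hr := hrank v u (cv.trans cu.symm)
    simp only [cu, cv, reduceCtorEq, true_and, false_and, or_false] at hfu hfv
    rw [Fin.lt_def] at hr
    rw [abs_lt]
    omega
  · obtain ⟨u, hu⟩ := hval i (by omega) (by omega)
    obtain ⟨v, hv⟩ := hval j (by omega) (by omega)
    have hr := hrank v u
    have hr' := hrank u v
    rw [Fin.lt_def] at hr hr'
    rcases hf u with ⟨h1, h2, h3⟩ | ⟨h1, h2, h3⟩ | ⟨h1, h2, h3⟩ <;>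
    rcases hf v with ⟨h4, h5, h6⟩ | ⟨h4, h5, h6⟩ | ⟨h4, h5, h6⟩ <;>
    simp only [h1, h4, forall_true_left] at hr hr' <;> omega
  · funext v
    have h1 := habs v
    have h2 := hf v
    have h3 : σ⁻¹⁻¹ ((v : ℤ) + 1) = f v := by rw [inv_inv, hσf]
    have h4 := @colouring_eq_iff a n σ⁻¹ v
    rw [h3, h1] at h4
    rcases h2 with ⟨h5, h6, h7⟩ | ⟨h5, h6, h7⟩ | ⟨h5, h6, h7⟩ <;> rw [h5] at h4 ⊢ <;>
      simp only [position] at h4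
    · exact h4.1.2 (by omega)
    · exact h4.2.1.2 (by omega)
    · exact h4.2.2.2 (by omega)

/-! ### Matching the two sides of the identity -/

theorem qFactorial_eq {K : Type*} [Field K] (q : K) (m : ℕ) :
    qFactorial q m = qProd q m / (1 - q) ^ m := by
  induction m with
  | zero => simp [qFactorial, qProd]
  | succ m ih =>
    rw [qFactorial, Finset.prod_Icc_succ_top (by omega), ← qFactorial, ih, qInt, qProd_succ,
      pow_succ (1 - q), div_mul_div_comm]

theorem qMultinomial_add {K : Type*} [Field K] {q : K} (hq : ∀ t, q ^ (t + 1) ≠ 1) (r s : ℕ) :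
    qMultinomial q (r + s) [r, s] = qProd q (r + s) / (qProd q r * qProd q s) := by
  have h1 : (1 - q) ≠ 0 := sub_ne_zero.2 fun h => hq 0 (by simp [← h])
  have hr := qProd_ne_zero hq r
  have hs := qProd_ne_zero hq s
  simp only [qMultinomial, List.map_cons, List.map_nil, List.prod_cons, List.prod_nil, mul_one,
    qFactorial_eq, pow_add]
  field_simp

/-- The factors for i = 2k and i = 2k + 1 are 1 - x^k and 1 + x^k; the range starts at an even index
and ends at an odd one, so it splits into such pairs. -/
theorem prod_Icc_eq {K : Type*} [Field K] (x : K) (r s : ℕ) :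
    ∏ i ∈ Finset.Icc (2 * r + 1 + 1) (2 * r + 1 + 2 * s), (1 + (-1) ^ (i - 1) * x ^ (i / 2)) =
      ∏ t ∈ Finset.range s, (1 - (x ^ 2) ^ (r + t + 1)) := by
  induction s with
  | zero => simp
  | succ s ih =>
    rw [show 2 * r + 1 + 2 * (s + 1) = 2 * r + 1 + 2 * s + 1 + 1 by ring,
      Finset.prod_Icc_succ_top (by omega), Finset.prod_Icc_succ_top (by omega), ih,
      Finset.prod_range_succ, mul_assoc]
    congr 1
    rw [show 2 * r + 1 + 2 * s + 1 - 1 = 2 * (r + s) + 1 by omega,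
      show (2 * r + 1 + 2 * s + 1) / 2 = r + s + 1 by omega,
      show 2 * r + 1 + 2 * s + 1 + 1 - 1 = 2 * (r + s + 1) by omega,
      show (2 * r + 1 + 2 * s + 1 + 1) / 2 = r + s + 1 by omega, pow_succ, pow_mul, pow_mul (-1 : K)]
    simp only [even_two, Even.neg_pow, one_pow]
    ring

theorem algebraMap_genFun {a n : ℕ} (ha : 2 ≤ a) (han : a + 2 ≤ n) (ha' : Odd a) (hn : Odd n) :
    algebraMap (Polynomial ℤ) (RatFunc ℤ)
        (genFun n (Set.Icc 0 (a - 1) ∪ Set.Icc (a + 1) (n - 1))) =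
      ∑ c : Fin n → Place,
        if count c .fst = a then (-1) ^ colLen c * (RatFunc.X : RatFunc ℤ) ^ colOddLen c else 0 := by
  rw [genFun, map_sum, ← Finset.sum_filter]
  have hmem := @mem_quotient_iff a n ha han
  refine Finset.sum_bij (fun w _ => colouring a n w) (fun w hw => ?_) (fun w hw w' hw' h => ?_)
    (fun c hc => ?_) (fun w hw => ?_)
  · rw [Set.Finite.mem_toFinset, hmem] at hw
    exact Finset.mem_filter.2 ⟨Finset.mem_univ _, count_colouring (by omega) hw.2.signed⟩
  · rw [Set.Finite.mem_toFinset, hmem] at hw hw'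
    exact colouring_injective (by omega) (by omega) hw.1 hw'.1 hw.2 hw'.2 h
  · obtain ⟨w, h1, h2, h3⟩ :=
      exists_colouring_eq (by omega) (by omega) c (Finset.mem_filter.1 hc).2
    exact ⟨w, (Set.Finite.mem_toFinset _).2 (hmem.2 ⟨h1, h2⟩), h3⟩
  · rw [Set.Finite.mem_toFinset, hmem] at hw
    rw [hw.2.len_eq (by omega), hw.2.oddLen_eq (by omega) (by omega) ha' hn]
    simp

/-- Comparing degrees shows that q = X² is not a root of unity, which is what makes every `qProd`
invertible. -/
theorem ratFuncX_pow_ne_one (t : ℕ) : ((RatFunc.X : RatFunc ℤ) ^ 2) ^ (t + 1) ≠ 1 := by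
  intro h
  rw [← pow_mul, ← RatFunc.algebraMap_X, ← map_pow,
    ← map_one (algebraMap (Polynomial ℤ) (RatFunc ℤ))] at h
  have h' := congrArg Polynomial.natDegree (RatFunc.algebraMap_injective ℤ h)
  simp at h'

end TypeD

/-- The identity is stated in the field of fractions of `ℤ[x]`. -/
theorem proposition5p5 (n a₀ : ℕ) (ha₀ : 2 ≤ a₀) (han : a₀ ≤ n - 2)
    (ha₀_odd : a₀ ≡ 1 [MOD 2]) (hn_odd : n ≡ 1 [MOD 2]) :
    algebraMap (Polynomial ℤ) (RatFunc ℤ)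
        (TypeD.genFun n (Set.Icc 0 (a₀ - 1) ∪ Set.Icc (a₀ + 1) (n - 1))) =
      TypeD.qMultinomial ((RatFunc.X : RatFunc ℤ) ^ 2) ((n - 1) / 2)
          [(a₀ - 1) / 2, (n - a₀) / 2] *
        ∏ i ∈ Finset.Icc (a₀ + 1) n,
          (1 + (-1) ^ (i - 1) * (RatFunc.X : RatFunc ℤ) ^ (i / 2)) := by
  rw [Nat.ModEq] at ha₀_odd hn_odd
  rw [TypeD.algebraMap_genFun ha₀ (by omega) (Nat.odd_iff.2 ha₀_odd) (Nat.odd_iff.2 hn_odd)]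
  obtain ⟨r, rfl⟩ : ∃ r, a₀ = 2 * r + 1 := ⟨a₀ / 2, by omega⟩
  obtain ⟨s, rfl⟩ : ∃ s, n = 2 * r + 1 + 2 * s := ⟨(n - (2 * r + 1)) / 2, by omega⟩
  rw [TypeD.sum_colouring_eq TypeD.ratFuncX_pow_ne_one, TypeD.prod_Icc_eq,
    show (2 * r + 1 + 2 * s - 1) / 2 = r + s by omega, show (2 * r + 1 - 1) / 2 = r by omega,
    show (2 * r + 1 + 2 * s - (2 * r + 1)) / 2 = s by omega,
    TypeD.qMultinomial_add TypeD.ratFuncX_pow_ne_one]
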